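/- Let $\tau_{\mathcal A}:\mathcal A\to Q$ be a Lie affgebroid of rank $n$ over a (Hausdorff, $\sigma$-compact, smooth) manifold $Q$ of dimension $m$, modelled on the vector bundle $V$. That is, $\mathcal A$ is an affine bundle with a Lie bracket $[\![\cdot,\cdot]\!]_V$ on $\Gamma(V)$, an $\mathbb R$-linear action $D$ of $\Gamma(\mathcal A)$ on $\Gamma(V)$ and an affine anchor map $\rho_{\mathcal A}:\mathcal A\to TQ$ such that $D_X[\![Y,Z]\!]_V=[\![D_XY,Z]\!]_V+[\![Y,D_XZ]\!]_V$, $D_{X+Y}Z=D_XZ+[\![Y,Z]\!]_V$ and $D_X(fY)=fD_XY+\rho_{\mathcal A}(X)(f)Y$ for $X\in\Gamma(\mathcal A)$, $Y,Z\in\Gamma(V)$, $f\in C^\infty(Q)$. Let $\mathcal A^+=\mathrm{Aff}(\mathcal A,\mathbb R)$, let $1_{\mathcal A}\in\Gamma(\mathcal A^+)$ be the constant function $1$, and let $\widetilde{\mathcal A}=(\mathcal A^+)^*\supset\mathcal A$ be the bidual with the induced Lie algebroid structure $([\![\cdot,\cdot]\!],\rho)$, for which $1_{\mathcal A}$ is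 a $1$-cocycle. For a fibration $\pi:P\to Q$ let $\mathcal T^{\widetilde{\mathcal A}}P\to P$ be the prolongation of $\widetilde{\mathcal A}$ over $\pi$, with fibres $\mathcal T^{\widetilde{\mathcal A}}_pP=\{(a,X)\in\widetilde{\mathcal A}_{\pi(p)}\times T_pP : \rho(a)=T_p\pi(X)\}$; it is a Lie algebroid with anchor $(a,X)\mapsto X$ and bracket determined by $[\![(\sigma\circ\pi,X),(\tau\circ\pi,Y)]\!]=([\![\sigma,\tau]\!]\circ\pi,[X,Y])$ on projectable sections; let $d$ denote its differential. Let $\mathcal M\subseteq\mathcal A$ be an embedded submanifold of dimension $n+m-\bar m$, $0\le\bar m\le n$, such that $\mathcal M\to Q$ is a surjective submersion, and let $L:\mathcal A\to\mathbb R$ be smooth. Put $W_0=\mathcal A^+\oplus_Q\mathcal M$, with projections $\nu:W_0\to Q$ and $\pi_1:W_0\to\mathcal A^+$, and $H_{W_0}(\varphi,\mathrm a)=\varphi(\mathrm a)-L(\mathrm a)$. On $\mathcal T^{\widetilde{\mathcal A}}W_0$ put $\eta(a,X)=1_{\mathcal A}(a)$, let $\Omega$ be the pullback by $(\mathrm{Id},T\pi_1)$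 of the canonical symplectic section $-d\lambda$ of $\mathcal T^{\widetilde{\mathcal A}}\mathcal A^+$, where $\lambda(\varphi)(a,X)=\varphi(a)$, and put $\Omega_{W_0}=\Omega+dH_{W_0}\wedge\eta$. Let $W_1$ be the set of $w\in W_0$ for which there is $Z\in\mathcal T^{\widetilde{\mathcal A}}_wW_0$ with $i_Z\Omega_{W_0}(w)=0$ and $i_Z\eta(w)=1$, and let $W_1'=\{w\in W_1 : H_{W_0}(w)=0\}$, with its structure of embedded submanifold of $W_0$. Let $(\Omega_{W_1'},\eta_{W_1'})$ be the restriction of $(\Omega_{W_0},\eta)$ to the prolongation $\mathcal T^{\widetilde{\mathcal A}}W_1'\subseteq\mathcal T^{\widetilde{\mathcal A}}W_0$ of $\widetilde{\mathcal A}$ over $\nu_1'=\nu_{|W_1'}$. Suppose that $(\Omega_{W_1'},\eta_{W_1'})$ is a cosymplectic structure on the Lie algebroid $\mathcal T^{\widetilde{\mathcal A}}W_1'\to W_1'$ of rank $2n+1$, that is, $d\Omega_{W_1'}=0$, $d\eta_{W_1'}=0$ and $\eta_{W_1'}\wedge\Omega_{W_1'}^{\,n}$ vanishes nowhere. Then there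 is a unique smooth section $\zeta_1$ of $\mathcal T^{\widetilde{\mathcal A}}W_1'\to W_1'$ that solves the vakonomic problem $(L,\mathcal M)$, i.e. such that $i_{\zeta_1}\Omega_{W_0}=0$ (on all of $\mathcal T^{\widetilde{\mathcal A}}_wW_0$) and $i_{\zeta_1}\eta=1$ at every point $w\in W_1'$. Moreover $\zeta_1$ is the Reeb section of $(\Omega_{W_1'},\eta_{W_1'})$: it is the unique smooth section of $\mathcal T^{\widetilde{\mathcal A}}W_1'$ with $i_{\zeta_1}\Omega_{W_1'}=0$ and $i_{\zeta_1}\eta_{W_1'}=1$. -/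

import Mathlib

open Bundle Manifold Set Topology
open scoped ContDiff Manifold Bundle

noncomputable section

namespace Vakonomic

/-- The model space `ℝ^d`. -/
abbrev Eucl (d : ℕ) : Type := EuclideanSpace ℝ (Fin d)

section Base

variable (m n : ℕ) {Q : Type*} [TopologicalSpace Q] [ChartedSpace (Eucl m) Q]
  [IsManifold (𝓡 m) ∞ Q]
  (E : Q → Type*) [∀ x, AddCommGroup (E x)] [∀ x, Module ℝ (E x)]
  [∀ x, TopologicalSpace (E x)] [TopologicalSpace (TotalSpace (Eucl (n + 1)) E)]
  [FiberBundle (Eucl (n + 1)) E] [VectorBundle ℝ (Eucl (n + 1)) E]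
  [ContMDiffVectorBundle ∞ (Eucl (n + 1)) E (𝓡 m)]

/-- The dual vector bundle `E^*`. -/
abbrev Dual : Q → Type _ := fun x => E x →L[ℝ] Bundle.Trivial Q ℝ x

/-- Smooth sections of `E`. -/
abbrev Sec : Type _ := Cₛ^∞⟮𝓡 m; Eucl (n + 1), E⟯

/-- Smooth sections of `E^*`. -/
abbrev DualSec : Type _ := Cₛ^∞⟮𝓡 m; Eucl (n + 1) →L[ℝ] ℝ, Dual E⟯

/-- Smooth vector bundle maps `E → TQ` over the identity. -/
abbrev AnchorSec : Type _ :=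
  Cₛ^∞⟮𝓡 m; Eucl (n + 1) →L[ℝ] Eucl m, fun x : Q => E x →L[ℝ] TangentSpace (𝓡 m) x⟯

/-- The derivative `X(f)` of a real function along a tangent vector `X` at `p`. -/
def dirDeriv {EP : Type*} [NormedAddCommGroup EP] [NormedSpace ℝ EP] {HP : Type*}
    [TopologicalSpace HP] (J : ModelWithCorners ℝ EP HP) {P : Type*} [TopologicalSpace P]
    [ChartedSpace HP P] (f : P → ℝ) (p : P) (X : TangentSpace J p) : ℝ :=
  mfderiv J 𝓘(ℝ, ℝ) f p X

variable {m n E}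

/-- The smooth function `x ↦ φ_x (σ x)`. -/
def pair (φ : DualSec m n E) (σ : Sec m n E) : C^∞⟮𝓡 m, Q; 𝓘(ℝ, ℝ), ℝ⟯ :=
  ⟨fun x => φ x (σ x), by
    have h := ContMDiff.clm_bundle_apply (b := fun x : Q => x) φ.contMDiff σ.contMDiff
    intro x
    exact ((Bundle.contMDiffAt_totalSpace).1 (h x)).2⟩

/-- The section `f σ`. -/
def smulSec (f : C^∞⟮𝓡 m, Q; 𝓘(ℝ, ℝ), ℝ⟯) (σ : Sec m n E) : Sec m n E :=
  ⟨fun x => f x • σ x, ContMDiff.smul_section f.contMDiff σ.contMDiff⟩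

/-- The derivative `ρ(σ)(f)` of a function along the image of a section under the anchor. -/
def derivAlong (ρ : AnchorSec m n E) (σ : Sec m n E) (f : C^∞⟮𝓡 m, Q; 𝓘(ℝ, ℝ), ℝ⟯) :
    C^∞⟮𝓡 m, Q; 𝓘(ℝ, ℝ), ℝ⟯ :=
  ⟨fun x => mfderiv (𝓡 m) 𝓘(ℝ, ℝ) f x (ρ x (σ x)), by
    have h : ContMDiff (𝓡 m) (𝓡 m).tangent ∞
        (fun x : Q => (⟨x, ρ x (σ x)⟩ : TangentBundle (𝓡 m) Q)) :=
      ContMDiff.clm_bundle_apply (b := fun x : Q => x) ρ.contMDiff σ.contMDiff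
    have h2 := (f.contMDiff.contMDiff_tangentMap (m := ∞) (by simp)).comp h
    exact (contMDiff_snd_tangentBundle_modelSpace ℝ 𝓘(ℝ, ℝ)).comp h2⟩

variable (m n E) in
/-- An affine bundle `A → Q` of rank `n`, presented inside its bidual vector bundle `E = Ã` of rank
`n + 1`: the datum is the section `1_A` of `A^+ = E^*`, nowhere zero, and the fibres of `A` and
of its model vector bundle `V` are `A_x = {a ∈ E_x | 1_A(a) = 1}`, `V_x = {v ∈ E_x | 1_A(v) = 0}`.
Restriction to `A_x` identifies `E_x^*` with the affine functions on `A_x`, and `1_A` with the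
constant function `1`. -/
structure AffBundle where
  /-- The section `1_A` of `A^+`. -/
  one : DualSec m n E
  one_ne_zero : ∀ x, one x ≠ 0

namespace AffBundle

variable (𝒜 : AffBundle m n E)

/-- The total space of `A`, as a subset of that of `Ã`. -/
def total : Set (TotalSpace (Eucl (n + 1)) E) := {e | 𝒜.one e.proj e.2 = (1 : ℝ)}

/-- `Γ(V)`: the sections of the model vector bundle. -/
def VSec : Submodule ℝ (Sec m n E) where
  carrier := {σ | ∀ x, 𝒜.one x (σ x) = (0 : ℝ)}
  add_mem' {σ τ} hσ hτ x := by
    change 𝒜.one x (σ x + τ x) = (0 : ℝ)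
    rw [map_add]
    exact (congrArg₂ (fun a b : ℝ => a + b) (hσ x) (hτ x)).trans (add_zero 0)
  zero_mem' x := map_zero (𝒜.one x)
  smul_mem' c σ hσ x := by
    change 𝒜.one x (c • σ x) = (0 : ℝ)
    rw [map_smul]
    exact (congrArg (fun a : ℝ => c * a) (hσ x)).trans (mul_zero c)

/-- `Γ(A)`: the sections of the affine bundle. -/
def ASec : Type _ := {σ : Sec m n E // ∀ x, 𝒜.one x (σ x) = (1 : ℝ)}

variable {𝒜}

/-- `f Y` for a function `f` and `Y ∈ Γ(V)`. -/
def VSec.fsmul (f : C^∞⟮𝓡 m, Q; 𝓘(ℝ, ℝ), ℝ⟯) (Y : 𝒜.VSec) : 𝒜.VSec :=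
  ⟨smulSec f Y.1, fun x => by
    change 𝒜.one x (f x • Y.1 x) = (0 : ℝ)
    rw [map_smul]
    exact (congrArg (fun a : ℝ => f x * a) (Y.2 x)).trans (mul_zero _)⟩

/-- `X + Y` for `X ∈ Γ(A)` and `Y ∈ Γ(V)`. -/
def ASec.addV (X : 𝒜.ASec) (Y : 𝒜.VSec) : 𝒜.ASec :=
  ⟨X.1 + Y.1, fun x => by
    change 𝒜.one x (X.1 x + Y.1 x) = (1 : ℝ)
    rw [map_add]
    exact (congrArg₂ (fun a b : ℝ => a + b) (X.2 x) (Y.2 x)).trans (add_zero 1)⟩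

/-- The component `σ - 1_A(σ) e₀` of `σ ∈ Γ(Ã)` in `Γ(V)`, for a section `e₀` of `A`. -/
def ASec.vpart (e₀ : 𝒜.ASec) (σ : Sec m n E) : 𝒜.VSec :=
  ⟨σ - smulSec (pair 𝒜.one σ) e₀.1, fun x => by
    change 𝒜.one x (σ x - (𝒜.one x (σ x) : ℝ) • e₀.1 x) = (0 : ℝ)
    rw [map_sub, map_smul]
    have h : ((𝒜.one x (σ x) : ℝ) * (𝒜.one x (e₀.1 x) : ℝ)) = 𝒜.one x (σ x) := by
      rw [e₀.2 x, mul_one]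
    exact sub_eq_zero.2 h.symm⟩

/-- An affine bundle over a manifold has a global section. -/
theorem nonempty_ASec [T2Space Q] [SigmaCompactSpace Q] (𝒜 : AffBundle m n E) :
    Nonempty 𝒜.ASec := by
  have hconv : ∀ x, Convex ℝ {a : E x | 𝒜.one x a = (1 : ℝ)} := by
    intro x a ha b hb s t _ _ hst
    change 𝒜.one x (s • a + t • b) = (1 : ℝ)
    rw [map_add, map_smul, map_smul]
    have ha' : 𝒜.one x a = (1 : ℝ) := ha
    have hb' : 𝒜.one x b = (1 : ℝ) := hb
    rw [ha', hb']
    simpa using hst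
  have hloc : ∀ x₀ : Q, ∃ U ∈ 𝓝 x₀, ∃ s : (x : Q) → E x,
      ContMDiffOn (𝓡 m) ((𝓡 m).prod 𝓘(ℝ, Eucl (n + 1))) ∞
        (fun x => (⟨x, s x⟩ : TotalSpace (Eucl (n + 1)) E)) U ∧
      ∀ y ∈ U, s y ∈ {a : E y | 𝒜.one y a = (1 : ℝ)} := by
    intro x₀
    obtain ⟨a, ha⟩ : ∃ a, 𝒜.one x₀ a ≠ (0 : ℝ) := by
      by_contra! h
      exact 𝒜.one_ne_zero x₀ (ContinuousLinearMap.ext h)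
    obtain ⟨U, hU, hs⟩ := FiberBundle.exists_contMDiffOn_extend (k := ∞) (𝓡 m) (Eucl (n + 1)) a
    set s := FiberBundle.extend (Eucl (n + 1)) a with hsdef
    obtain ⟨V, hVU, hV, hxV⟩ := mem_nhds_iff.1 hU
    let g : Q → ℝ := fun x => 𝒜.one x (s x)
    have hg : ContMDiffOn (𝓡 m) 𝓘(ℝ, ℝ) ∞ g V := by
      have h := ContMDiffOn.clm_bundle_apply (b := fun x : Q => x)
        (𝒜.one.contMDiff.contMDiffOn (s := V)) (hs.mono hVU)
      intro x hx
      exact ((Bundle.contMDiffWithinAt_totalSpace).1 (h x hx)).2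
    have hg0 : g x₀ ≠ 0 := by
      have : s x₀ = a := by simp [hsdef]
      simpa [g, this] using ha
    have hgc : ContinuousAt g x₀ := (hg.continuousOn).continuousAt (hV.mem_nhds hxV)
    refine ⟨V ∩ {y | g y ≠ 0}, Filter.inter_mem (hV.mem_nhds hxV) (hgc.eventually_ne hg0),
      fun x => (g x)⁻¹ • s x, ?_, ?_⟩
    · exact ContMDiffOn.smul_section
        (fun x hx => ((hg x hx.1).mono inter_subset_left).inv₀ hx.2)
        ((hs.mono hVU).mono inter_subset_left)
    · rintro y ⟨-, hy⟩
      change 𝒜.one y ((g y)⁻¹ • s y) = (1 : ℝ)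
      rw [map_smul]
      exact inv_mul_cancel₀ hy
  obtain ⟨s, hs⟩ := exists_contMDiffSection_forall_mem_convex_of_local (𝓡 m) (n := ⊤)
    (F_fiber := Eucl (n + 1)) E (fun x => {a | 𝒜.one x a = (1 : ℝ)}) hconv hloc
  exact ⟨⟨s, hs⟩⟩

end AffBundle

variable (m n E) in
/-- A Lie affgebroid of rank `n` over the `m`-dimensional manifold `Q`: an affine bundle `A` with a
Lie bracket on `Γ(V)`, an `ℝ`-linear action `D` of `Γ(A)` on `Γ(V)` and an affine anchor map
`ρ_A : A → TQ`. An affine map on `A_x` being the same as a linear map on `Ã_x`, the anchor is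
given by its unique linear extension `ρ_Ã : Ã → TQ`; its restriction to `V` is `ρ_V`. -/
structure LieAffgebroid extends AffBundle m n E where
  /-- The anchor map. -/
  anchor : AnchorSec m n E
  /-- The Lie bracket on `Γ(V)`. -/
  bracketV : toAffBundle.VSec →ₗ[ℝ] toAffBundle.VSec →ₗ[ℝ] toAffBundle.VSec
  /-- The action of `Γ(A)` on `Γ(V)`. -/
  D : toAffBundle.ASec → toAffBundle.VSec →ₗ[ℝ] toAffBundle.VSec
  bracketV_self : ∀ Y, bracketV Y Y = 0
  bracketV_jacobi : ∀ Y Z W,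
    bracketV Y (bracketV Z W) + bracketV Z (bracketV W Y) + bracketV W (bracketV Y Z) = 0
  D_bracketV : ∀ X Y Z, D X (bracketV Y Z) = bracketV (D X Y) Z + bracketV Y (D X Z)
  D_add : ∀ (X : toAffBundle.ASec) (Y Z : toAffBundle.VSec),
    D (X.addV Y) Z = D X Z + bracketV Y Z
  D_fsmul : ∀ (X : toAffBundle.ASec) (f : C^∞⟮𝓡 m, Q; 𝓘(ℝ, ℝ), ℝ⟯) (Y : toAffBundle.VSec),
    D X (AffBundle.VSec.fsmul f Y) =
      AffBundle.VSec.fsmul f (D X Y) + AffBundle.VSec.fsmul (derivAlong anchor X.1 f) Y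

namespace LieAffgebroid

variable [T2Space Q] [SigmaCompactSpace Q] (𝒜 : LieAffgebroid m n E)

/-- The Lie bracket on `Γ(Ã)` induced by the Lie affgebroid structure. It is the bracket for which
`⟦Y, Z⟧ = ⟦Y, Z⟧_V`, `⟦X, Y⟧ = D_X Y` (`X ∈ Γ(A)`, `Y, Z ∈ Γ(V)`) and `1_A` is a `1`-cocycle. To
write it down, split `σ = Y + f e₀` with a section `e₀` of `A`; the axioms make the result
independent of `e₀`. -/
def bracket (σ τ : Sec m n E) : Sec m n E :=
  let e₀ : 𝒜.ASec := Classical.choice 𝒜.nonempty_ASec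
  let Y : 𝒜.VSec := e₀.vpart σ
  let Z : 𝒜.VSec := e₀.vpart τ
  let f := pair 𝒜.one σ
  let g := pair 𝒜.one τ
  (𝒜.bracketV Y Z).1 + smulSec f (𝒜.D e₀ Z).1 - smulSec g (𝒜.D e₀ Y).1
    + smulSec (derivAlong 𝒜.anchor σ g - derivAlong 𝒜.anchor τ f) e₀.1

/-! ### Prolongation of `Ã` over a fibration -/

section Prolongation

variable {EP : Type*} [NormedAddCommGroup EP] [NormedSpace ℝ EP] {HP : Type*} [TopologicalSpace HP]
  (J : ModelWithCorners ℝ EP HP) {P : Type*} [TopologicalSpace P] [ChartedSpace HP P]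
  [IsManifold J ∞ P] (pr : P → Q)

/-- The fibre `𝒯^Ã_p P = {(a, X) ∈ Ã_{pr(p)} × T_p P | ρ_Ã(a) = T_p pr(X)}` of the prolongation of
`Ã` over `pr : P → Q`. -/
def prolong (p : P) : Submodule ℝ (E (pr p) × TangentSpace J p) where
  carrier := {z | 𝒜.anchor (pr p) z.1 = mfderiv J (𝓡 m) pr p z.2}
  add_mem' {z w} hz hw := by
    change 𝒜.anchor (pr p) (z.1 + w.1) = mfderiv J (𝓡 m) pr p (z.2 + w.2)
    rw [map_add, map_add]
    exact congrArg₂ (· + ·) hz hw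
  zero_mem' := (map_zero (𝒜.anchor (pr p))).trans (map_zero (mfderiv J (𝓡 m) pr p)).symm
  smul_mem' c z hz := by
    change 𝒜.anchor (pr p) (c • z.1) = mfderiv J (𝓡 m) pr p (c • z.2)
    rw [map_smul, map_smul]
    exact congrArg (c • ·) hz

/-- A smooth section of the prolongation `𝒯^Ã P → P`. -/
structure ProlSection where
  /-- The component in `Ã`. -/
  fst : ∀ p : P, E (pr p)
  /-- The component in `TP`. -/
  snd : ∀ p : P, TangentSpace J p
  mem : ∀ p : P, (fst p, snd p) ∈ 𝒜.prolong J pr p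
  smooth_fst : ContMDiff J ((𝓡 m).prod 𝓘(ℝ, Eucl (n + 1))) ∞
    (fun p => (⟨pr p, fst p⟩ : TotalSpace (Eucl (n + 1)) E))
  smooth_snd : ContMDiff J J.tangent ∞ (fun p => (⟨p, snd p⟩ : TangentBundle J P))

variable {J} in
/-- The value of a section of the prolongation at a point. -/
def ProlSection.val {𝒜 : LieAffgebroid m n E} {pr : P → Q}
    (ζ : ProlSection 𝒜 J pr) (p : P) : E (pr p) × TangentSpace J p := (ζ.fst p, ζ.snd p)

/-- A projectable section of the prolongation, defined near the point `p`: a pair `(σ ∘ pr, X)` with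
`σ ∈ Γ(Ã)` and `X` a vector field which is smooth and `pr`-projectable to `ρ_Ã(σ)` near `p`. These
sections span the prolongation. -/
structure ProjSection (p : P) where
  /-- The section of `Ã`. -/
  σ : Sec m n E
  /-- The vector field. -/
  X : ∀ q : P, TangentSpace J q
  smooth : ∀ᶠ q in 𝓝 p, ContMDiffAt J J.tangent ∞ (fun q => (⟨q, X q⟩ : TangentBundle J P)) q
  mem : ∀ᶠ q in 𝓝 p, (σ (pr q), X q) ∈ 𝒜.prolong J pr q

variable {J pr}

/-- The value at `q` of a projectable section. -/
def ProjSection.val {𝒜 : LieAffgebroid m n E} {p : P} (Z : ProjSection 𝒜 J pr p) (q : P) :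
    E (pr q) × TangentSpace J q := (Z.σ (pr q), Z.X q)

/-- The bracket `⟦(σ ∘ pr, X), (τ ∘ pr, Y)⟧ = (⟦σ, τ⟧ ∘ pr, [X, Y])` of projectable sections, which
determines the Lie algebroid structure of the prolongation. -/
def ProjSection.bracket {𝒜 : LieAffgebroid m n E} {p : P} (Z W : ProjSection 𝒜 J pr p) (q : P) :
    E (pr q) × TangentSpace J q := (𝒜.bracket Z.σ W.σ (pr q), VectorField.mlieBracket J Z.X W.X q)

/-- The derivative at `p` of a function along the anchor image `X` of `Z = (σ ∘ pr, X)`. -/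
def ProjSection.deriv {𝒜 : LieAffgebroid m n E} {p : P} (Z : ProjSection 𝒜 J pr p) (f : P → ℝ) : ℝ :=
  dirDeriv J f p (Z.X p)

variable (J pr)

/-- `d η = 0` for a section `η` of the dual of the prolongation. Multisections are given by
their values on pairs `(a, X)`; only the values on the prolongation play a role. -/
def IsClosed₁ (η : ∀ p, E (pr p) × TangentSpace J p → ℝ) : Prop :=
  ∀ (p : P) (Z₀ Z₁ : ProjSection 𝒜 J pr p),
    Z₀.deriv (fun q => η q (Z₁.val q)) - Z₁.deriv (fun q => η q (Z₀.val q))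
      - η p (Z₀.bracket Z₁ p) = 0

/-- `d Ω = 0` for a 2-section `Ω` of the prolongation. -/
def IsClosed₂ (Ω : ∀ p, E (pr p) × TangentSpace J p → E (pr p) × TangentSpace J p → ℝ) : Prop :=
  ∀ (p : P) (Z₀ Z₁ Z₂ : ProjSection 𝒜 J pr p),
    Z₀.deriv (fun q => Ω q (Z₁.val q) (Z₂.val q)) - Z₁.deriv (fun q => Ω q (Z₀.val q) (Z₂.val q))
      + Z₂.deriv (fun q => Ω q (Z₀.val q) (Z₁.val q))
      - Ω p (Z₀.bracket Z₁ p) (Z₂.val p) + Ω p (Z₀.bracket Z₂ p) (Z₁.val p)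
      - Ω p (Z₁.bracket Z₂ p) (Z₀.val p) = 0

/-- The value of `η ∧ Ω ∧ ⋯ ∧ Ω` (`r` factors `Ω`) on `2r + 1` vectors, up to the positive
normalisation constant of the wedge product. -/
def wedgeTop {V : Type*} (η : V → ℝ) (Ω : V → V → ℝ) (r : ℕ) (z : Fin (2 * r + 1) → V) : ℝ :=
  ∑ s : Equiv.Perm (Fin (2 * r + 1)), (Equiv.Perm.sign s : ℝ) * (η (z (s 0)) *
    ∏ i : Fin r, Ω (z (s ⟨2 * i + 1, by omega⟩)) (z (s ⟨2 * i + 2, by omega⟩)))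

/-- `(Ω, η)` is a cosymplectic structure on the prolongation `𝒯^Ã P → P`, a Lie algebroid of rank
`2r + 1`: `dΩ = 0`, `dη = 0` and `η ∧ Ω^r` vanishes nowhere. -/
structure IsCosymplectic (r : ℕ)
    (Ω : ∀ p, E (pr p) × TangentSpace J p → E (pr p) × TangentSpace J p → ℝ)
    (η : ∀ p, E (pr p) × TangentSpace J p → ℝ) : Prop where
  closed_two : 𝒜.IsClosed₂ J pr Ω
  closed_one : 𝒜.IsClosed₁ J pr η
  rank : ∀ p, Module.finrank ℝ (𝒜.prolong J pr p) = 2 * r + 1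
  nondegenerate : ∀ p, ∃ z : Fin (2 * r + 1) → E (pr p) × TangentSpace J p,
    (∀ i, z i ∈ 𝒜.prolong J pr p) ∧ wedgeTop (η p) (Ω p) r z ≠ 0

/-- The Reeb section of `(Ω, η)`: `i_ζ Ω = 0` and `i_ζ η = 1`. -/
def IsReeb (Ω : ∀ p, E (pr p) × TangentSpace J p → E (pr p) × TangentSpace J p → ℝ)
    (η : ∀ p, E (pr p) × TangentSpace J p → ℝ) (ζ : ProlSection 𝒜 J pr) : Prop :=
  ∀ p, (∀ z ∈ 𝒜.prolong J pr p, Ω p (ζ.val p) z = 0) ∧ η p (ζ.val p) = 1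

end Prolongation

/-! ### The canonical symplectic section of `𝒯^Ã A^+` -/

/-- The total space of `A^+`, identified with `Ã^*`. -/
abbrev DualTotal (_ : LieAffgebroid m n E) : Type _ :=
  TotalSpace (Eucl (n + 1) →L[ℝ] ℝ) (Dual E)

/-- The model with corners of `A^+`. -/
abbrev dualModel (_ : LieAffgebroid m n E) :
    ModelWithCorners ℝ (Eucl m × (Eucl (n + 1) →L[ℝ] ℝ))
      (ModelProd (Eucl m) (Eucl (n + 1) →L[ℝ] ℝ)) :=
  (𝓡 m).prod 𝓘(ℝ, Eucl (n + 1) →L[ℝ] ℝ)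

/-- The Liouville section `λ(φ)(a, X) = φ(a)` of the dual of `𝒯^Ã A^+`. -/
def liouville (φ : 𝒜.DualTotal) (z : E φ.proj × TangentSpace 𝒜.dualModel φ) : ℝ := φ.2 z.1

/-- The value at `φ ∈ A^+` of `-dλ` on two projectable sections `(σ ∘ pr, X)`, `(τ ∘ pr, Y)` of
`𝒯^Ã A^+`. As `λ(σ ∘ pr, X)` is the function `ψ ↦ ψ(σ)`, it depends on `X` and `Y` only through
their values at `φ`. -/
def negDLiouville (φ : 𝒜.DualTotal) (σ τ : Sec m n E) (X Y : TangentSpace 𝒜.dualModel φ) : ℝ :=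
  -(dirDeriv 𝒜.dualModel (fun ψ : 𝒜.DualTotal => (ψ.2 (τ ψ.proj) : ℝ)) φ X
    - dirDeriv 𝒜.dualModel (fun ψ : 𝒜.DualTotal => (ψ.2 (σ ψ.proj) : ℝ)) φ Y
    - φ.2 (𝒜.bracket σ τ φ.proj))

/-- `negDLiouville` is minus the Koszul expression of the differential of the Liouville section. -/
theorem negDLiouville_eq (φ : 𝒜.DualTotal)
    (Z W : ProjSection 𝒜 𝒜.dualModel (TotalSpace.proj : 𝒜.DualTotal → Q) φ) :
    𝒜.negDLiouville φ Z.σ W.σ (Z.X φ) (W.X φ) =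
      -(Z.deriv (fun ψ => 𝒜.liouville ψ (W.val ψ)) - W.deriv (fun ψ => 𝒜.liouville ψ (Z.val ψ))
        - 𝒜.liouville φ (Z.bracket W φ)) := rfl

/-- A smooth section of `Ã` whose value at `x` is `a` (such sections exist). -/
def extend {x : Q} (a : E x) : Sec m n E := Classical.epsilon fun σ : Sec m n E => σ x = a

/-- The canonical symplectic section `Ω_Ã = -dλ` of `𝒯^Ã A^+`. Its value at `φ` on two elements
`(a, X)`, `(b, Y)` of the prolongation is computed on extensions of `a` and `b` to sections of `Ã`;
it does not depend on the extensions, because `Tpr(X) = ρ_Ã(a)` and `Tpr(Y) = ρ_Ã(b)`. -/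
def canonicalForm (φ : 𝒜.DualTotal) (z w : E φ.proj × TangentSpace 𝒜.dualModel φ) : ℝ :=
  𝒜.negDLiouville φ (extend z.1) (extend w.1) z.2 w.2

/-! ### The vakonomic problem -/

/-- `M` is a constraint submanifold: an embedded submanifold of `A`, of dimension `d`, such that
`M → Q` is a surjective submersion. (`A` being an embedded submanifold of `Ã`, the embedded
submanifolds of `A` are those of `Ã` contained in `A`.) -/
structure IsConstraintSubmanifold (d : ℕ) (M : Set (TotalSpace (Eucl (n + 1)) E))
    [ChartedSpace (Eucl d) M] : Prop where
  subset : M ⊆ 𝒜.total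
  embedded : IsSmoothEmbedding (𝓡 d) ((𝓡 m).prod 𝓘(ℝ, Eucl (n + 1))) ∞
    (Subtype.val : M → TotalSpace (Eucl (n + 1)) E)
  surjective : Function.Surjective (fun e : M => e.1.proj)
  submersion : ∀ e : M, Function.Surjective (mfderiv (𝓡 d) (𝓡 m) (fun e : M => e.1.proj) e)

section Vakonomic

variable {𝒜} {d : ℕ} {M : Set (TotalSpace (Eucl (n + 1)) E)} [ChartedSpace (Eucl d) M]
  [IsManifold (𝓡 d) ∞ M]

/-- The projection `τ_M : M → Q`. -/
def IsConstraintSubmanifold.τ (hM : 𝒜.IsConstraintSubmanifold d M) :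
    ContMDiffMap (𝓡 d) (𝓡 m) M Q ∞ :=
  ⟨fun e => e.1.proj, (Bundle.contMDiff_proj E).comp hM.embedded.contMDiff⟩

/-- The manifold `W₀ = A^+ ⊕_Q M`: the pullback of `A^+` along `τ_M`, whose points are the pairs
`(φ, e)` with `e ∈ M` and `φ` in the fibre of `A^+` over `τ_M(e)`. -/
abbrev W₀ (hM : 𝒜.IsConstraintSubmanifold d M) : Type _ :=
  TotalSpace (Eucl (n + 1) →L[ℝ] ℝ) ((hM.τ : M → Q) *ᵖ (Dual E))

/-- The model with corners of `W₀`. -/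
abbrev W₀model (_ : 𝒜.IsConstraintSubmanifold d M) :
    ModelWithCorners ℝ (Eucl d × (Eucl (n + 1) →L[ℝ] ℝ))
      (ModelProd (Eucl d) (Eucl (n + 1) →L[ℝ] ℝ)) :=
  (𝓡 d).prod 𝓘(ℝ, Eucl (n + 1) →L[ℝ] ℝ)

variable (hM : 𝒜.IsConstraintSubmanifold d M)

/-- The projection `ν : W₀ → Q`. -/
def ν (w : W₀ hM) : Q := w.proj.1.proj

/-- The projection `π₁ : W₀ → A^+`. -/
def π₁ (w : W₀ hM) : 𝒜.DualTotal := ⟨ν hM w, w.2⟩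

/-- The section `Ω = (𝒯π₁, π₁)^* Ω_Ã` of `𝒯^Ã W₀`, where `𝒯π₁ = (Id, Tπ₁)`. -/
def Omega (w : W₀ hM) (z z' : E (ν hM w) × TangentSpace (W₀model hM) w) : ℝ :=
  𝒜.canonicalForm (π₁ hM w)
    (z.1, mfderiv (W₀model hM) 𝒜.dualModel (π₁ hM) w z.2)
    (z'.1, mfderiv (W₀model hM) 𝒜.dualModel (π₁ hM) w z'.2)

/-- The section `η = (pr₁, ν)^* 1_A`. -/
def eta (w : W₀ hM) (z : E (ν hM w) × TangentSpace (W₀model hM) w) : ℝ := 𝒜.one (ν hM w) z.1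

/-- The Pontryagin Hamiltonian `H_{W₀}(φ, e) = φ(e) - L(e)`. -/
def pontryagin (L : TotalSpace (Eucl (n + 1)) E → ℝ) (w : W₀ hM) : ℝ :=
  (π₁ hM w).2 w.proj.1.2 - L w.proj.1

/-- `(d H_{W₀})(a, X) = X(H_{W₀})`. -/
def dPontryagin (L : TotalSpace (Eucl (n + 1)) E → ℝ) (w : W₀ hM)
    (z : E (ν hM w) × TangentSpace (W₀model hM) w) : ℝ :=
  dirDeriv (W₀model hM) (pontryagin hM L) w z.2

/-- The section `Ω_{W₀} = Ω + d H_{W₀} ∧ η`. -/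
def OmegaW₀ (L : TotalSpace (Eucl (n + 1)) E → ℝ) (w : W₀ hM)
    (z z' : E (ν hM w) × TangentSpace (W₀model hM) w) : ℝ :=
  Omega hM w z z' + (dPontryagin hM L w z * eta hM w z' - dPontryagin hM L w z' * eta hM w z)

/-- The points of `W₀` at which the equations `i_Z Ω_{W₀} = 0`, `i_Z η = 1` have a solution. -/
def W₁ (L : TotalSpace (Eucl (n + 1)) E → ℝ) : Set (W₀ hM) :=
  {w | ∃ Z ∈ 𝒜.prolong (W₀model hM) (ν hM) w,
    (∀ z ∈ 𝒜.prolong (W₀model hM) (ν hM) w, OmegaW₀ hM L w Z z = 0) ∧ eta hM w Z = 1}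

/-- `W₁' = {w ∈ W₁ | H_{W₀}(w) = 0}`. -/
def W₁' (L : TotalSpace (Eucl (n + 1)) E → ℝ) : Set (W₀ hM) :=
  {w | w ∈ W₁ hM L ∧ pontryagin hM L w = 0}

section Restriction

variable (L : TotalSpace (Eucl (n + 1)) E → ℝ) (k : ℕ) [ChartedSpace (Eucl k) (W₁' hM L)]
  [IsManifold (𝓡 k) ∞ (W₁' hM L)]

/-- The projection `ν₁' : W₁' → Q`. -/
def ν₁' (w : W₁' hM L) : Q := ν hM w.1

/-- The inclusion `𝒯^Ã W₁' → 𝒯^Ã W₀`, `(a, X) ↦ (a, T incl (X))`. -/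
def incl (w : W₁' hM L) (z : E (ν₁' hM L w) × TangentSpace (𝓡 k) w) :
    E (ν hM w.1) × TangentSpace (W₀model hM) w.1 :=
  (z.1, mfderiv (𝓡 k) (W₀model hM) (Subtype.val : W₁' hM L → W₀ hM) w z.2)

/-- `Ω_{W₁'}`, the restriction of `Ω_{W₀}` to `𝒯^Ã W₁'`. -/
def OmegaW₁' (w : W₁' hM L) (z z' : E (ν₁' hM L w) × TangentSpace (𝓡 k) w) : ℝ :=
  OmegaW₀ hM L w.1 (incl hM L k w z) (incl hM L k w z')

/-- `η_{W₁'}`, the restriction of `η` to `𝒯^Ã W₁'`. -/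
def etaW₁' (w : W₁' hM L) (z : E (ν₁' hM L w) × TangentSpace (𝓡 k) w) : ℝ :=
  eta hM w.1 (incl hM L k w z)

/-- A section `ζ` of `𝒯^Ã W₁' → W₁'` solves the vakonomic problem if `i_ζ Ω_{W₀} = 0` and
`i_ζ η = 1` along `W₁'`; here `Ω_{W₀}` is contracted with all of `𝒯^Ã W₀`. -/
def IsVakonomicSolution (ζ : ProlSection 𝒜 (𝓡 k) (ν₁' hM L)) : Prop :=
  ∀ w : W₁' hM L,
    (∀ z ∈ 𝒜.prolong (W₀model hM) (ν hM) w.1, OmegaW₀ hM L w.1 (incl hM L k w (ζ.val w)) z = 0) ∧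
      eta hM w.1 (incl hM L k w (ζ.val w)) = 1

end Restriction

end Vakonomic

end LieAffgebroid

end Base

end Vakonomic

end

noncomputable section

namespace Vakonomic

set_option linter.unusedSectionVars false

/-! ### Linear algebra of cosymplectic forms and of skew forms of bounded rank. -/

section LinearAlgebra

variable {V : Type*} [AddCommGroup V] [Module ℝ V]

/-! The core is a dimension count that passes from the kernel of the restricted form to the kernel
of Ω_{W₀}. At w ∈ W₁ take Z with i_Z Ω_{W₀} = 0 and η(Z) = 1. If v is killed by (Id, Tπ₁), then
Ω_{W₀}(v, ·) = dH(v) η, and evaluation on Z gives dH(v) = 0. So ker (Id, Tπ₁) lies in ker Ω_{W₀},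
and strictly so, since Z is in the latter only (`ker_prolongπ₁_lt`). The fibres of the prolongation
over A⁺ have dimension 2n + 2, hence Ω_{W₀} has rank at most 2n + 1 at w (`finrank_prolongW₀_le`),
which is the rank of the prolongation over W₁'.

Now let S be a fibre over W₁', embedded in the fibre T over W₀, and let R be the Reeb vector. If S
meets ker Ω_{W₀} trivially, dimensions force T = S ⊕ ker Ω_{W₀}, and Ω_{W₀}(R, ·) vanishes on both
summands. Otherwise a nonzero common vector lies in the kernel of the restricted form, which is the
line of R. Either way R ∈ ker Ω_{W₀} (`apply_eq_zero_of_finrank_le`). Conversely a vakonomic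
solution restricts to a Reeb section, and Reeb sections are unique because ker Ω ∩ ker η = 0 on W₁'.

The Reeb vector exists pointwise: a skew form in odd dimension has a nonzero kernel vector, and η
cannot vanish on it. For smoothness, H = 0 on W₁' removes the term dH ∧ η, so Ω_{W₁'} is the
pullback of the canonical form along W₁' → A⁺. In a local frame of the pullback of Ã plus the
tangent bundle, the prolongation is the kernel of a smooth family of matrices of constant rank, and
the Reeb section solves the nondegenerate equation (Ω + η ⊗ η)(ζ, ·) = η
(`contMDiffAt_of_kernel_equation`).

All this needs the canonical form to be bilinear and independent of the extensions used to compute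
it (`canonicalForm_eq`); that rests on the Leibniz rule of the induced bracket on Γ(Ã). -/

theorem Fin.exists_eq_two_mul {r : ℕ} (j : Fin (2 * r + 1)) : j = 0 ∨ ∃ i : Fin r,
    j = ⟨2 * i + 1, by omega⟩ ∨ j = ⟨2 * i + 2, by omega⟩ := by
  by_cases hj : j.1 = 0
  · exact .inl (Fin.ext hj)
  · have := j.2
    refine .inr ⟨⟨(j.1 - 1) / 2, by omega⟩, ?_⟩
    simp only [Fin.ext_iff]
    omega

/-- The summand of `wedgeTop` for the identity permutation. -/
def wedgeSummand (η : V →ₗ[ℝ] ℝ) (Ω : V →ₗ[ℝ] V →ₗ[ℝ] ℝ) (r : ℕ) (z : Fin (2 * r + 1) → V) : ℝ :=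
  η (z 0) * ∏ i : Fin r, Ω (z ⟨2 * i + 1, by omega⟩) (z ⟨2 * i + 2, by omega⟩)

/-- Each argument occurs in exactly one factor of the product, so freezing the other arguments
leaves a scalar multiple of η, Ω(·, y) or Ω(x, ·). Additivity and homogeneity in a slot both follow.
-/
theorem exists_linear_wedgeSummand_update (η : V →ₗ[ℝ] ℝ) (Ω : V →ₗ[ℝ] V →ₗ[ℝ] ℝ) (r : ℕ)
    (z : Fin (2 * r + 1) → V) (j : Fin (2 * r + 1)) :
    ∃ ℓ : V →ₗ[ℝ] ℝ, ∀ v, wedgeSummand η Ω r (Function.update z j v) = ℓ v := by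
  have hne (i i₀ : Fin r) (h : i ∈ Finset.univ.erase i₀) : i.1 ≠ i₀.1 :=
    fun h' => Finset.ne_of_mem_erase h (Fin.ext h')
  obtain rfl | ⟨i₀, rfl | rfl⟩ := Fin.exists_eq_two_mul j
  · refine ⟨(∏ i : Fin r, Ω (z ⟨2 * i + 1, by omega⟩) (z ⟨2 * i + 2, by omega⟩)) • η, fun v => ?_⟩
    simp only [wedgeSummand, Function.update_self, LinearMap.smul_apply, smul_eq_mul]
    rw [mul_comm]
    congr 1
  · refine ⟨(η (z 0) * ∏ i ∈ Finset.univ.erase i₀, Ω (z ⟨2 * i + 1, by omega⟩)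
      (z ⟨2 * i + 2, by omega⟩)) • Ω.flip (z ⟨2 * i₀ + 2, by omega⟩), fun v => ?_⟩
    simp only [wedgeSummand, ← Finset.mul_prod_erase _ _ (Finset.mem_univ i₀),
      Function.update_self, LinearMap.smul_apply, smul_eq_mul, LinearMap.flip_apply]
    rw [Function.update_of_ne (by simp [Fin.ext_iff]), Function.update_of_ne (by simp [Fin.ext_iff]),
      mul_assoc, mul_comm (Ω v _)]
    refine congrArg₂ _ rfl (congrArg₂ _ (Finset.prod_congr rfl fun i hi => ?_) rfl)
    have := hne i i₀ hi
    rw [Function.update_of_ne (by simp only [ne_eq, Fin.ext_iff]; omega),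
      Function.update_of_ne (by simp only [ne_eq, Fin.ext_iff]; omega)]
  · refine ⟨(η (z 0) * ∏ i ∈ Finset.univ.erase i₀, Ω (z ⟨2 * i + 1, by omega⟩)
      (z ⟨2 * i + 2, by omega⟩)) • Ω (z ⟨2 * i₀ + 1, by omega⟩), fun v => ?_⟩
    simp only [wedgeSummand, ← Finset.mul_prod_erase _ _ (Finset.mem_univ i₀),
      Function.update_self, LinearMap.smul_apply, smul_eq_mul]
    rw [Function.update_of_ne (by simp [Fin.ext_iff]), Function.update_of_ne (by simp [Fin.ext_iff]),
      mul_assoc, mul_comm (Ω _ v)]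
    refine congrArg₂ _ rfl (congrArg₂ _ (Finset.prod_congr rfl fun i hi => ?_) rfl)
    have := hne i i₀ hi
    rw [Function.update_of_ne (by simp only [ne_eq, Fin.ext_iff]; omega),
      Function.update_of_ne (by simp only [ne_eq, Fin.ext_iff]; omega)]

/-- The multilinear map whose alternatization is `wedgeTop`. -/
def wedgeMultilinear (η : V →ₗ[ℝ] ℝ) (Ω : V →ₗ[ℝ] V →ₗ[ℝ] ℝ) (r : ℕ) :
    MultilinearMap ℝ (fun _ : Fin (2 * r + 1) => V) ℝ :=
  .mk' (wedgeSummand η Ω r)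
    (fun z j x y => by
      obtain ⟨ℓ, hℓ⟩ := exists_linear_wedgeSummand_update η Ω r z j
      rw [hℓ, hℓ, hℓ, map_add])
    (fun z j c x => by
      obtain ⟨ℓ, hℓ⟩ := exists_linear_wedgeSummand_update η Ω r z j
      rw [hℓ, hℓ, map_smul])

/-- Makes η ∧ Ω^r available as an alternating map, which in dimension 2r + 1 is a multiple of the
determinant. -/
theorem wedgeTop_eq_alternatization (η : V →ₗ[ℝ] ℝ) (Ω : V →ₗ[ℝ] V →ₗ[ℝ] ℝ) (r : ℕ)
    (z : Fin (2 * r + 1) → V) :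
    LieAffgebroid.wedgeTop η (fun u v => Ω u v) r z =
      MultilinearMap.alternatization (wedgeMultilinear η Ω r) z := by
  rw [MultilinearMap.alternatization_apply]
  refine Finset.sum_congr rfl fun s _ => ?_
  rw [Units.smul_def, zsmul_eq_mul]
  rfl

/-- If `η ∧ Ω^r` does not vanish on a space of dimension `2r + 1`, then `ker Ω ∩ ker η = 0`. -/
theorem eq_zero_of_wedgeTop_ne_zero {r : ℕ} (hV : Module.finrank ℝ V = 2 * r + 1)
    (η : V →ₗ[ℝ] ℝ) (Ω : V →ₗ[ℝ] V →ₗ[ℝ] ℝ) (hΩ : ∀ u v, Ω u v = -Ω v u)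
    (z : Fin (2 * r + 1) → V) (hz : LieAffgebroid.wedgeTop η (fun u v => Ω u v) r z ≠ 0)
    (v : V) (hv : ∀ u, Ω v u = 0) (hηv : η v = 0) : v = 0 := by
  have : FiniteDimensional ℝ V := FiniteDimensional.of_finrank_pos (by omega)
  rw [wedgeTop_eq_alternatization] at hz
  set A := MultilinearMap.alternatization (wedgeMultilinear η Ω r) with hA
  -- In every permuted summand v appears once, as an argument of η or of Ω, and that factor is zero.
  have key (w : Fin (2 * r + 1) → V) (j : Fin (2 * r + 1)) (hj : w j = v) : A w = 0 := by
    rw [hA, MultilinearMap.alternatization_apply]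
    refine Finset.sum_eq_zero fun s _ => ?_
    rw [MultilinearMap.domDomCongr_apply]
    have : wedgeMultilinear η Ω r (fun i => w (s i)) = 0 := by
      change η (w (s 0)) * ∏ i : Fin r,
        Ω (w (s ⟨2 * i + 1, by omega⟩)) (w (s ⟨2 * i + 2, by omega⟩)) = 0
      obtain ⟨l, hl⟩ := s.surjective j
      obtain rfl | ⟨i₀, rfl | rfl⟩ := Fin.exists_eq_two_mul l
      · rw [hl, hj, hηv, zero_mul]
      · refine mul_eq_zero_of_right _ (Finset.prod_eq_zero (Finset.mem_univ i₀) ?_)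
        rw [hl, hj, hv]
      · refine mul_eq_zero_of_right _ (Finset.prod_eq_zero (Finset.mem_univ i₀) ?_)
        rw [hl, hj, hΩ, hv, neg_zero]
    rw [this, smul_zero]
  by_contra hv0
  let b := Module.finBasisOfFinrankEq ℝ V hV
  obtain ⟨j, hj⟩ : ∃ j, b.repr v j ≠ 0 := by
    by_contra! h
    exact hv0 (b.repr.map_eq_zero_iff.1 (Finsupp.ext h))
  -- Expanding v in the basis, only its j-th component survives, the others repeating a basis
  -- vector. The left side is zero by `key`, so A vanishes on the basis and hence identically.
  have h1 : A (Function.update b j v) = b.repr v j • A b := by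
    conv_lhs => rw [← b.sum_repr v]
    rw [A.map_update_sum, Finset.sum_eq_single j]
    · rw [A.map_update_smul, Function.update_eq_self]
    · intro i _ hij
      rw [A.map_update_smul, A.map_update_self _ hij.symm, smul_zero]
    · simp
  rw [key _ j (Function.update_self ..)] at h1
  have hAb : A b = 0 := (smul_eq_zero.1 h1.symm).resolve_left hj
  rw [A.eq_smul_basis_det b, hAb, zero_smul] at hz
  exact hz rfl

/-- A skew-symmetric form on an odd-dimensional space is degenerate. -/
theorem exists_ne_zero_of_skew_of_odd {r : ℕ} (hV : Module.finrank ℝ V = 2 * r + 1)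
    (Ω : V →ₗ[ℝ] V →ₗ[ℝ] ℝ) (hΩ : ∀ u v, Ω u v = -Ω v u) : ∃ v ≠ 0, ∀ u, Ω v u = 0 := by
  have : FiniteDimensional ℝ V := FiniteDimensional.of_finrank_pos (by omega)
  let b := Module.finBasisOfFinrankEq ℝ V hV
  let A : Matrix (Fin (2 * r + 1)) (Fin (2 * r + 1)) ℝ := .of fun i j => Ω (b i) (b j)
  -- The Gram matrix is skew of odd size, so det A = det Aᵀ = -det A.
  have hA : A.det = 0 := by
    have h1 : A.transpose = -A := by ext i j; exact hΩ _ _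
    have h2 := A.det_transpose
    rw [h1, Matrix.det_neg, Fintype.card_fin, Odd.neg_one_pow ⟨r, rfl⟩] at h2
    linarith
  obtain ⟨c, hc0, hc⟩ := Matrix.exists_vecMul_eq_zero_iff.2 hA
  refine ⟨∑ i, c i • b i, fun h => hc0 ?_, fun u => ?_⟩
  · exact funext (Fintype.linearIndependent_iff.1 b.linearIndependent c h)
  · have : Ω (∑ i, c i • b i) = 0 := b.ext fun j => by
      have := congrFun hc j
      simpa [Matrix.vecMul, dotProduct, A] using this
    rw [this, LinearMap.zero_apply]

/-- The Reeb vector of a linear cosymplectic structure. -/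
theorem exists_reeb_vector {r : ℕ} (hV : Module.finrank ℝ V = 2 * r + 1)
    (η : V →ₗ[ℝ] ℝ) (Ω : V →ₗ[ℝ] V →ₗ[ℝ] ℝ) (hΩ : ∀ u v, Ω u v = -Ω v u)
    (h : ∀ v, (∀ u, Ω v u = 0) → η v = 0 → v = 0) : ∃ v, (∀ u, Ω v u = 0) ∧ η v = 1 := by
  obtain ⟨v, hv0, hv⟩ := exists_ne_zero_of_skew_of_odd hV Ω hΩ
  have hη : η v ≠ 0 := fun h' => hv0 (h v hv h')
  exact ⟨(η v)⁻¹ • v, fun u => by simp [hv], by simp [hη]⟩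

/-- Let `Ω` be a skew form on `T` whose rank is at most `dim S`, and whose pullback to `S` has a
kernel spanned by `R`. Then the image of `R` lies in the kernel of `Ω`. -/
theorem apply_eq_zero_of_finrank_le {S T : Type*} [AddCommGroup S] [Module ℝ S] [AddCommGroup T]
    [Module ℝ T] [FiniteDimensional ℝ T] (j : S →ₗ[ℝ] T) (hj : Function.Injective j)
    (Ω : T →ₗ[ℝ] T →ₗ[ℝ] ℝ) (hΩ : ∀ u v, Ω u v = -Ω v u) (R : S)
    (hR : ∀ s, Ω (j R) (j s) = 0) (hker : ∀ s, (∀ s', Ω (j s) (j s') = 0) → ∃ c : ℝ, s = c • R)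
    (hdim : Module.finrank ℝ T ≤ Module.finrank ℝ S + Module.finrank ℝ (LinearMap.ker Ω)) :
    Ω (j R) = 0 := by
  by_cases hinf : LinearMap.range j ⊓ LinearMap.ker Ω = ⊥
  · have h1 := Submodule.finrank_sup_add_finrank_inf_eq (LinearMap.range j) (LinearMap.ker Ω)
    rw [hinf, finrank_bot, LinearMap.finrank_range_of_inj hj] at h1
    -- A trivial intersection together with `hdim` makes the sum fill T; R pairs to zero with the
    -- image of S by `hR` and with the kernel by skewness.
    have htop : LinearMap.range j ⊔ LinearMap.ker Ω = ⊤ :=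
      Submodule.eq_top_of_finrank_eq (le_antisymm (Submodule.finrank_le _) (by omega))
    ext t
    obtain ⟨_, ⟨s, rfl⟩, k, hk, rfl⟩ := Submodule.mem_sup.1 (htop ▸ Submodule.mem_top : t ∈ _)
    rw [map_add, hR, hΩ _ k, LinearMap.mem_ker.1 hk]
    simp
  -- A nonzero common vector is also in the kernel of the pullback, hence a nonzero multiple of R.
  · obtain ⟨_, ⟨⟨s, rfl⟩, hs⟩, hs0⟩ := (Submodule.ne_bot_iff _).1 hinf
    have hs : Ω (j s) = 0 := hs
    obtain ⟨c, rfl⟩ := hker s fun s' => by rw [hs, LinearMap.zero_apply]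
    have hc : c ≠ 0 := by rintro rfl; simp at hs0
    rw [map_smul, map_smul] at hs
    exact (smul_eq_zero.1 hs).resolve_left hc

end LinearAlgebra

/-! ### Smooth dependence of solutions of linear equations on kernels of constant rank. -/

section SmoothSolution

variable {EP : Type*} [NormedAddCommGroup EP] [NormedSpace ℝ EP] {HP : Type*} [TopologicalSpace HP]
  {J : ModelWithCorners ℝ EP HP} {P : Type*} [TopologicalSpace P] [ChartedSpace HP P]
  {N M : Type*} [NormedAddCommGroup N] [NormedSpace ℝ N] [FiniteDimensional ℝ N]
  [NormedAddCommGroup M] [NormedSpace ℝ M] [FiniteDimensional ℝ M]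

theorem _root_.ContMDiffAt.clm_inverse {F G : Type*} [NormedAddCommGroup F] [NormedSpace ℝ F]
    [CompleteSpace F] [NormedAddCommGroup G] [NormedSpace ℝ G] {A : P → F →L[ℝ] G} {p : P}
    (hA : ContMDiffAt J 𝓘(ℝ, F →L[ℝ] G) ∞ A p) (h : (A p).IsInvertible) :
    ContMDiffAt J 𝓘(ℝ, G →L[ℝ] F) ∞ (fun q => (A q).inverse) p :=
  (h.contDiffAt_map_inverse (n := ∞)).contMDiffAt.comp p hA

theorem finrank_continuousDual (K : Type*) [NormedAddCommGroup K] [NormedSpace ℝ K]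
    [FiniteDimensional ℝ K] : Module.finrank ℝ (K →L[ℝ] ℝ) = Module.finrank ℝ K :=
  (LinearMap.toContinuousLinearMap (𝕜 := ℝ) (E := K) (F' := ℝ)).finrank_eq.symm.trans
    Subspace.dual_finrank_eq

theorem isInvertible_of_injective {F G : Type*} [NormedAddCommGroup F] [NormedSpace ℝ F]
    [FiniteDimensional ℝ F] [NormedAddCommGroup G] [NormedSpace ℝ G] [FiniteDimensional ℝ G]
    (h : Module.finrank ℝ F = Module.finrank ℝ G) (A : F →L[ℝ] G) (hA : Function.Injective A) :
    A.IsInvertible :=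
  ⟨(LinearEquiv.ofInjectiveOfFinrankEq (A : F →ₗ[ℝ] G) hA h).toContinuousLinearEquiv,
    ContinuousLinearMap.ext fun _ => rfl⟩

theorem eventually_isInvertible {F G : Type*} [NormedAddCommGroup F] [NormedSpace ℝ F]
    [CompleteSpace F] [NormedAddCommGroup G] [NormedSpace ℝ G] {A : P → F →L[ℝ] G} {p : P}
    (hA : ContinuousAt A p) (h : (A p).IsInvertible) : ∀ᶠ q in 𝓝 p, (A q).IsInvertible := by
  obtain ⟨e, he⟩ := h
  rw [ContinuousAt, ← he] at hA
  filter_upwards [hA e.nhds] with q hq using hq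

/-- The kernels of a smooth family of linear maps of locally constant rank have a smooth local
parametrization by the kernel at the base point. -/
theorem exists_kernel_parametrization {p : P} {G : P → N →L[ℝ] M}
    (hG : ContMDiffAt J 𝓘(ℝ, N →L[ℝ] M) ∞ G p)
    (hrank : ∀ᶠ q in 𝓝 p, Module.finrank ℝ (LinearMap.ker (G q : N →ₗ[ℝ] M)) =
      Module.finrank ℝ (LinearMap.ker (G p : N →ₗ[ℝ] M)))
    (K : Submodule ℝ N) (hK : K = LinearMap.ker (G p : N →ₗ[ℝ] M)) :
    ∃ S : P → K →L[ℝ] N, ContMDiffAt J 𝓘(ℝ, K →L[ℝ] N) ∞ S p ∧ (∀ k, S p k = k) ∧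
      ∀ᶠ q in 𝓝 p, ∀ z, G q z = 0 ↔ ∃ k, S q k = z := by
  have hKmem (z : N) : z ∈ K ↔ G p z = 0 := by rw [hK]; rfl
  -- r projects N onto the kernel K at p. Since (r, G p) is injective it has a left inverse T, which
  -- turns (r, G q) into an endomorphism close to the identity.
  obtain ⟨r, hr⟩ := K.subtype.exists_leftInverse_of_injective K.ker_subtype
  have hrK (k : K) : r k = k := LinearMap.congr_fun hr k
  have hinj : Function.Injective (r.prod (G p : N →ₗ[ℝ] M)) := by
    rw [injective_iff_map_eq_zero]
    intro z hz
    obtain ⟨hz1, hz2⟩ := Prod.ext_iff.1 hz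
    have := hrK ⟨z, (hKmem z).2 hz2⟩
    exact congrArg Subtype.val (this.symm.trans hz1)
  obtain ⟨T, hT⟩ := LinearMap.exists_leftInverse_of_injective _ (LinearMap.ker_eq_bot.2 hinj)
  have hTK (k : K) : T (k, 0) = k := by
    have := LinearMap.congr_fun hT k
    have hk : G p k = 0 := (hKmem k).1 k.2
    simpa [hrK, hk] using this
  -- `A q` maps `ker G q` into `ker G p`, and `A p = 1`.
  let A : P → N →L[ℝ] N := fun q => T.toContinuousLinearMap.comp
    (r.toContinuousLinearMap.prod (G q))
  have hAapply (q : P) (z : N) : A q z = T (r z, G q z) := rfl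
  have hAp : A p = ContinuousLinearMap.id ℝ N := by
    ext z
    exact LinearMap.congr_fun hT z
  have hA : ContMDiffAt J 𝓘(ℝ, N →L[ℝ] N) ∞ A p := by
    have h1 : A = fun q => T.toContinuousLinearMap.comp
        ((ContinuousLinearMap.inl ℝ K M).comp r.toContinuousLinearMap +
          (ContinuousLinearMap.inr ℝ K M).comp (G q)) := by
      funext q
      ext z
      change T (r z, G q z) = T ((r z, 0) + (0, G q z))
      simp
    rw [h1]
    exact contMDiffAt_const.clm_comp (contMDiffAt_const.add (contMDiffAt_const.clm_comp hG))
  have hApinv : (A p).IsInvertible := ⟨.refl ℝ N, hAp.symm⟩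
  refine ⟨fun q => (A q).inverse.comp K.subtypeL,
    (hA.clm_inverse hApinv).clm_comp contMDiffAt_const, fun k => ?_, ?_⟩
  · change (A p).inverse k = k
    rw [hAp, ContinuousLinearMap.inverse_id]
    rfl
  filter_upwards [eventually_isInvertible hA.continuousAt hApinv, hrank] with q hAq hrq z
  -- Invertibility of A q and the constant rank upgrade the inclusion in K to an equality; without
  -- it the inverse of A q need not carry K into the kernel of G q.
  have hmap : Submodule.map (A q : N →ₗ[ℝ] N) (LinearMap.ker (G q : N →ₗ[ℝ] M)) = K := by
    refine Submodule.eq_of_le_of_finrank_eq ?_ ?_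
    · rintro _ ⟨z, hz, rfl⟩
      have hz : G q z = 0 := hz
      change A q z ∈ K
      rw [hAapply, hz, hTK]
      exact (r z).2
    · rw [hK, ← hrq]
      exact (Submodule.equivMapOfInjective _ hAq.injective _).finrank_eq.symm
  constructor
  · intro hz
    exact ⟨⟨A q z, hmap.le ⟨z, hz, rfl⟩⟩, hAq.inverse_apply_self z⟩
  · rintro ⟨k, rfl⟩
    obtain ⟨z, hz, hzk⟩ := hmap.ge k.2
    have : (A q).inverse k = z := by
      rw [← hzk]
      exact hAq.inverse_apply_self z
    change G q ((A q).inverse k) = 0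
    rw [this]
    exact hz

/-- The solution of a smooth nondegenerate linear equation `B q (c q) = β q` on the range of a
smooth family `S q` of linear maps, taken in this range, is smooth. -/
theorem contMDiffAt_of_equation_on_range {K : Type*} [NormedAddCommGroup K] [NormedSpace ℝ K]
    [FiniteDimensional ℝ K] {p : P} {S : P → K →L[ℝ] N} {B : P → N →L[ℝ] N →L[ℝ] ℝ}
    {β : P → N →L[ℝ] ℝ} {c : P → N} (hS : ContMDiffAt J 𝓘(ℝ, K →L[ℝ] N) ∞ S p)
    (hB : ContMDiffAt J 𝓘(ℝ, N →L[ℝ] N →L[ℝ] ℝ) ∞ B p)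
    (hβ : ContMDiffAt J 𝓘(ℝ, N →L[ℝ] ℝ) ∞ β p)
    (hc : ∀ᶠ q in 𝓝 p, (∃ k, S q k = c q) ∧ ∀ k, B q (c q) (S q k) = β q (S q k))
    (hnd : ∀ k, (∀ k', B p (S p k) (S p k') = 0) → k = 0) :
    ContMDiffAt J 𝓘(ℝ, N) ∞ c p := by
  -- The pullback of B along S. It is invertible at p, hence nearby, so the solution there is S
  -- D⁻¹(β ∘ S), visibly smooth.
  let D : P → K →L[ℝ] K →L[ℝ] ℝ := fun q => ((S q).precomp ℝ).comp ((B q).comp (S q))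
  have hDapply (q : P) (k k' : K) : D q k k' = B q (S q k) (S q k') := rfl
  have hD : ContMDiffAt J 𝓘(ℝ, K →L[ℝ] K →L[ℝ] ℝ) ∞ D p := by
    have h1 : ContMDiffAt J 𝓘(ℝ, K →L[ℝ] N →L[ℝ] ℝ) ∞ (fun q => (B q).comp (S q)) p :=
      hB.clm_comp hS
    have h2 : ContMDiffAt J 𝓘(ℝ, (N →L[ℝ] ℝ) →L[ℝ] (K →L[ℝ] ℝ)) ∞
      (fun q => (S q).precomp ℝ) p := hS.clm_precomp
    exact ContMDiffAt.clm_comp (F₁ := N →L[ℝ] ℝ) (F₂ := K) (F₃ := K →L[ℝ] ℝ) h2 h1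
  have hDinj : Function.Injective (D p) := by
    rw [injective_iff_map_eq_zero]
    intro k hk
    refine hnd k fun k' => ?_
    rw [← hDapply, hk]
    rfl
  have hDinv : (D p).IsInvertible :=
    isInvertible_of_injective (finrank_continuousDual K).symm _ hDinj
  have hfinal : ContMDiffAt J 𝓘(ℝ, N) ∞
      (fun q => S q ((D q).inverse ((β q).comp (S q)))) p :=
    hS.clm_apply ((hD.clm_inverse hDinv).clm_apply (hβ.clm_comp hS))
  refine hfinal.congr_of_eventuallyEq ?_
  filter_upwards [eventually_isInvertible hD.continuousAt hDinv, hc] with q hDq hcq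
  obtain ⟨⟨k, hk⟩, hcq⟩ := hcq
  have : (β q).comp (S q) = D q k := by
    ext k'
    rw [hDapply, hk]
    exact (hcq k').symm
  rw [this, hDq.inverse_apply_self, hk]

/-- Let `G q : N → M` be a smooth family of linear maps of locally constant rank and `B q`, `β q`
smooth families of forms on `N`. If `B p` is nondegenerate on `ker G p`, then the solution
`c q ∈ ker G q` of `B q (c q) = β q` on `ker G q` is smooth at `p`. -/
theorem contMDiffAt_of_kernel_equation {p : P} {G : P → N →L[ℝ] M} {B : P → N →L[ℝ] N →L[ℝ] ℝ}
    {β : P → N →L[ℝ] ℝ} {c : P → N} (hG : ContMDiffAt J 𝓘(ℝ, N →L[ℝ] M) ∞ G p)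
    (hB : ContMDiffAt J 𝓘(ℝ, N →L[ℝ] N →L[ℝ] ℝ) ∞ B p)
    (hβ : ContMDiffAt J 𝓘(ℝ, N →L[ℝ] ℝ) ∞ β p)
    (hrank : ∀ᶠ q in 𝓝 p, Module.finrank ℝ (LinearMap.ker (G q : N →ₗ[ℝ] M)) =
      Module.finrank ℝ (LinearMap.ker (G p : N →ₗ[ℝ] M)))
    (hc : ∀ᶠ q in 𝓝 p, G q (c q) = 0 ∧ ∀ z, G q z = 0 → B q (c q) z = β q z)
    (hnd : ∀ z, G p z = 0 → (∀ z', G p z' = 0 → B p z z' = 0) → z = 0) :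
    ContMDiffAt J 𝓘(ℝ, N) ∞ c p := by
  obtain ⟨S, hS, hSp, hSG⟩ := exists_kernel_parametrization hG hrank _ rfl
  refine contMDiffAt_of_equation_on_range hS hB hβ ?_ fun k hk => ?_
  · filter_upwards [hSG, hc] with q hSq hcq
    exact ⟨(hSq _).1 hcq.1, fun k => hcq.2 _ ((hSq _).2 ⟨k, rfl⟩)⟩
  · refine Subtype.ext (hnd k k.2 fun z' hz' => ?_)
    simpa only [hSp] using hk ⟨z', hz'⟩

end SmoothSolution

/-! ### The induced bracket on Γ(Ã): antisymmetry, additivity and Leibniz rules. -/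

section Bracket

variable {m n : ℕ} {Q : Type*} [TopologicalSpace Q] [ChartedSpace (Eucl m) Q]
  [IsManifold (𝓡 m) ∞ Q]
  {E : Q → Type*} [∀ x, AddCommGroup (E x)] [∀ x, Module ℝ (E x)]
  [∀ x, TopologicalSpace (E x)] [TopologicalSpace (TotalSpace (Eucl (n + 1)) E)]
  [FiberBundle (Eucl (n + 1)) E] [VectorBundle ℝ (Eucl (n + 1)) E]
  [ContMDiffVectorBundle ∞ (Eucl (n + 1)) E (𝓡 m)]

@[simp]
theorem smulSec_apply (f : C^∞⟮𝓡 m, Q; 𝓘(ℝ, ℝ), ℝ⟯) (σ : Sec m n E) (x : Q) :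
    smulSec f σ x = f x • σ x := rfl

@[simp]
theorem pair_smulSec (φ : DualSec m n E) (f : C^∞⟮𝓡 m, Q; 𝓘(ℝ, ℝ), ℝ⟯) (σ : Sec m n E) :
    pair φ (smulSec f σ) = f * pair φ σ := by
  ext x
  exact map_smul (φ x) (f x) (σ x)

@[simp]
theorem pair_add (φ : DualSec m n E) (σ τ : Sec m n E) : pair φ (σ + τ) = pair φ σ + pair φ τ := by
  ext x
  exact map_add (φ x) (σ x) (τ x)

theorem mdifferentiableAt_coe (f : C^∞⟮𝓡 m, Q; 𝓘(ℝ, ℝ), ℝ⟯) (x : Q) :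
    MDifferentiableAt (𝓡 m) 𝓘(ℝ, ℝ) f x := f.contMDiff.mdifferentiableAt (by simp)

variable (ρ : AnchorSec m n E)

@[simp]
theorem derivAlong_add_left (σ τ : Sec m n E) (f : C^∞⟮𝓡 m, Q; 𝓘(ℝ, ℝ), ℝ⟯) :
    derivAlong ρ (σ + τ) f = derivAlong ρ σ f + derivAlong ρ τ f := by
  ext x
  change mfderiv (𝓡 m) 𝓘(ℝ, ℝ) f x (ρ x (σ x + τ x)) = _
  rw [map_add, map_add]
  rfl

@[simp]
theorem derivAlong_smulSec (g : C^∞⟮𝓡 m, Q; 𝓘(ℝ, ℝ), ℝ⟯) (σ : Sec m n E)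
    (f : C^∞⟮𝓡 m, Q; 𝓘(ℝ, ℝ), ℝ⟯) :
    derivAlong ρ (smulSec g σ) f = g * derivAlong ρ σ f := by
  ext x
  change mfderiv (𝓡 m) 𝓘(ℝ, ℝ) f x (ρ x (g x • σ x)) = _
  rw [map_smul, map_smul]
  rfl

@[simp]
theorem derivAlong_add_right (σ : Sec m n E) (f g : C^∞⟮𝓡 m, Q; 𝓘(ℝ, ℝ), ℝ⟯) :
    derivAlong ρ σ (f + g) = derivAlong ρ σ f + derivAlong ρ σ g := by
  ext x
  have h := mfderiv_add (mdifferentiableAt_coe f x) (mdifferentiableAt_coe g x)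
  exact congrArg (fun φ : TangentSpace (𝓡 m) x →L[ℝ] ℝ => φ (ρ x (σ x))) h

@[simp]
theorem derivAlong_mul (σ : Sec m n E) (f g : C^∞⟮𝓡 m, Q; 𝓘(ℝ, ℝ), ℝ⟯) :
    derivAlong ρ σ (f * g) = f * derivAlong ρ σ g + g * derivAlong ρ σ f := by
  ext x
  have h := (mdifferentiableAt_coe f x).hasMFDerivAt.mul (mdifferentiableAt_coe g x).hasMFDerivAt
  exact congrArg (fun φ : TangentSpace (𝓡 m) x →L[ℝ] ℝ => φ (ρ x (σ x))) h.mfderiv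

@[simp]
theorem derivAlong_const (σ : Sec m n E) (c : ℝ) :
    derivAlong ρ σ (ContMDiffMap.const c) = 0 := by
  ext x
  exact congrArg (fun φ : TangentSpace (𝓡 m) x →L[ℝ] ℝ => φ (ρ x (σ x))) mfderiv_const

namespace LieAffgebroid

variable (𝒜 : LieAffgebroid m n E)

theorem bracketV_antisymm (Y Z : 𝒜.VSec) : 𝒜.bracketV Y Z = -𝒜.bracketV Z Y := by
  have h := 𝒜.bracketV_self (Y + Z)
  simp only [map_add, LinearMap.add_apply, 𝒜.bracketV_self, zero_add, add_zero] at h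
  exact eq_neg_of_add_eq_zero_right h

theorem vpart_add_smulSec (e₀ : 𝒜.ASec) (σ : Sec m n E) :
    (e₀.vpart σ).1 + smulSec (pair 𝒜.one σ) e₀.1 = σ :=
  sub_add_cancel _ _

theorem vpart_add (e₀ : 𝒜.ASec) (σ τ : Sec m n E) :
    e₀.vpart (σ + τ) = e₀.vpart σ + e₀.vpart τ := by
  refine Subtype.ext (ContMDiffSection.ext fun x => ?_)
  change σ x + τ x - (pair 𝒜.one (σ + τ) x) • e₀.1 x =
    (σ x - (pair 𝒜.one σ x) • e₀.1 x) + (τ x - (pair 𝒜.one τ x) • e₀.1 x)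
  rw [pair_add, ContMDiffMap.coe_add, Pi.add_apply]
  module

theorem vpart_smulSec (e₀ : 𝒜.ASec) (f : C^∞⟮𝓡 m, Q; 𝓘(ℝ, ℝ), ℝ⟯) (σ : Sec m n E) :
    e₀.vpart (smulSec f σ) = AffBundle.VSec.fsmul f (e₀.vpart σ) := by
  refine Subtype.ext (ContMDiffSection.ext fun x => ?_)
  change f x • σ x - (pair 𝒜.one (smulSec f σ) x) • e₀.1 x =
    f x • (σ x - (pair 𝒜.one σ x) • e₀.1 x)
  rw [pair_smulSec, ContMDiffMap.coe_mul, Pi.mul_apply]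
  module

/-- This is not an axiom: since bracketing with Y is the difference of D along X + Y and along X, it
follows by subtracting their Leibniz rules. Any global section X of A serves. -/
theorem bracketV_fsmul_right [T2Space Q] [SigmaCompactSpace Q] (Y Z : 𝒜.VSec)
    (f : C^∞⟮𝓡 m, Q; 𝓘(ℝ, ℝ), ℝ⟯) :
    𝒜.bracketV Y (AffBundle.VSec.fsmul f Z) = AffBundle.VSec.fsmul f (𝒜.bracketV Y Z) +
      AffBundle.VSec.fsmul (derivAlong 𝒜.anchor Y.1 f) Z := by
  obtain ⟨X⟩ := 𝒜.nonempty_ASec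
  have h1 := 𝒜.D_add X Y (AffBundle.VSec.fsmul f Z)
  rw [𝒜.D_fsmul, 𝒜.D_fsmul, 𝒜.D_add] at h1
  have h2 : derivAlong 𝒜.anchor (X.addV Y).1 f =
    derivAlong 𝒜.anchor X.1 f + derivAlong 𝒜.anchor Y.1 f := derivAlong_add_left _ _ _ _
  rw [h2] at h1
  refine Subtype.ext (ContMDiffSection.ext fun x => ?_)
  have h3 := congrArg (fun Z : 𝒜.VSec => Z.1 x) h1
  change f x • ((𝒜.D X Z).1 x + (𝒜.bracketV Y Z).1 x) + (derivAlong 𝒜.anchor X.1 f x +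
    derivAlong 𝒜.anchor Y.1 f x) • Z.1 x = f x • (𝒜.D X Z).1 x + derivAlong 𝒜.anchor X.1 f x • Z.1 x
      + (𝒜.bracketV Y (AffBundle.VSec.fsmul f Z)).1 x at h3
  change _ = f x • (𝒜.bracketV Y Z).1 x + derivAlong 𝒜.anchor Y.1 f x • Z.1 x
  rw [smul_add, add_smul, ← sub_eq_zero] at h3
  rw [← sub_eq_zero, ← neg_eq_zero, ← h3]
  abel

variable [T2Space Q] [SigmaCompactSpace Q]

theorem bracket_antisymm (σ τ : Sec m n E) : 𝒜.bracket σ τ = -𝒜.bracket τ σ := by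
  ext x
  simp only [bracket, 𝒜.bracketV_antisymm (AffBundle.ASec.vpart _ σ)]
  simp
  module

theorem bracket_add_right (σ τ τ' : Sec m n E) :
    𝒜.bracket σ (τ + τ') = 𝒜.bracket σ τ + 𝒜.bracket σ τ' := by
  ext x
  simp only [bracket, vpart_add, map_add, pair_add, derivAlong_add_right, derivAlong_add_left]
  simp
  module

theorem bracket_add_left (σ σ' τ : Sec m n E) :
    𝒜.bracket (σ + σ') τ = 𝒜.bracket σ τ + 𝒜.bracket σ' τ := by
  rw [bracket_antisymm, bracket_add_right, bracket_antisymm _ τ σ, bracket_antisymm _ τ σ']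
  abel

theorem bracket_smulSec_right (f : C^∞⟮𝓡 m, Q; 𝓘(ℝ, ℝ), ℝ⟯) (σ τ : Sec m n E) :
    𝒜.bracket σ (smulSec f τ) = smulSec f (𝒜.bracket σ τ) +
      smulSec (derivAlong 𝒜.anchor σ f) τ := by
  ext x
  simp only [bracket, vpart_smulSec, bracketV_fsmul_right, D_fsmul, pair_smulSec, derivAlong_mul,
    derivAlong_smulSec]
  set e₀ : 𝒜.ASec := Classical.choice 𝒜.nonempty_ASec
  -- The Leibniz terms come separately from the V-component of σ and from its e₀-component; the
  -- anchor is linear, so they recombine to ρ(σ)(f).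
  have hσ : derivAlong 𝒜.anchor σ f x = derivAlong 𝒜.anchor (e₀.vpart σ).1 f x +
      pair 𝒜.one σ x * derivAlong 𝒜.anchor e₀.1 f x := by
    conv_lhs => rw [← vpart_add_smulSec 𝒜 e₀ σ, derivAlong_add_left, derivAlong_smulSec]
    rfl
  have hτ : τ x = (e₀.vpart τ).1 x + pair 𝒜.one τ x • e₀.1 x :=
    (congrArg (fun σ : Sec m n E => σ x) (vpart_add_smulSec 𝒜 e₀ τ)).symm
  have h1 (f : C^∞⟮𝓡 m, Q; 𝓘(ℝ, ℝ), ℝ⟯) (Z : 𝒜.VSec) :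
    (AffBundle.VSec.fsmul f Z).1 x = f x • Z.1 x := rfl
  simp only [ContMDiffSection.coe_add, ContMDiffSection.coe_sub, Pi.add_apply, Pi.sub_apply,
    Submodule.coe_add, h1, smulSec_apply, ContMDiffMap.coe_mul, ContMDiffMap.coe_add,
    ContMDiffMap.coe_sub, Pi.mul_apply, hσ, hτ, smul_add, smul_sub, add_smul, sub_smul, mul_smul]
  module

theorem bracket_smulSec_left (f : C^∞⟮𝓡 m, Q; 𝓘(ℝ, ℝ), ℝ⟯) (σ τ : Sec m n E) :
    𝒜.bracket (smulSec f σ) τ = smulSec f (𝒜.bracket σ τ) -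
      smulSec (derivAlong 𝒜.anchor τ f) σ := by
  rw [bracket_antisymm, bracket_smulSec_right, bracket_antisymm _ σ τ]
  ext x
  simp
  abel

theorem bracket_smul_left (c : ℝ) (σ τ : Sec m n E) :
    𝒜.bracket (c • σ) τ = c • 𝒜.bracket σ τ := by
  have h := 𝒜.bracket_smulSec_left (ContMDiffMap.const c) σ τ
  rw [derivAlong_const] at h
  refine h.trans (ContMDiffSection.ext fun x => ?_)
  simp
  rfl

end LieAffgebroid
end Bracket

/-! ### Global frames by cutoff, and locality of functionals on sections. -/

section Frame

variable {m n : ℕ} {Q : Type*} [TopologicalSpace Q] [ChartedSpace (Eucl m) Q]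
  [IsManifold (𝓡 m) ∞ Q] [T2Space Q]
  {E : Q → Type*} [∀ x, AddCommGroup (E x)] [∀ x, Module ℝ (E x)]
  [∀ x, TopologicalSpace (E x)] [TopologicalSpace (TotalSpace (Eucl (n + 1)) E)]
  [FiberBundle (Eucl (n + 1)) E] [VectorBundle ℝ (Eucl (n + 1)) E]
  [ContMDiffVectorBundle ∞ (Eucl (n + 1)) E (𝓡 m)]

/-- The model basis of `ℝ^d`. -/
abbrev stdBasis (d : ℕ) : Module.Basis (Fin d) ℝ (Eucl d) := (EuclideanSpace.basisFun _ ℝ).toBasis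

theorem sec_sum_apply {ι : Type*} (s : Finset ι) (σ : ι → Sec m n E) (x : Q) :
    (∑ i ∈ s, σ i) x = ∑ i ∈ s, σ i x := by
  rw [← ContMDiffSection.coeAddHom_apply, map_sum, Finset.sum_apply]
  rfl

/-- Global sections `e i` which near `x` form a local frame, together with smooth coefficients. -/
theorem exists_global_frame (x : Q) : ∃ (χ : C^∞⟮𝓡 m, Q; 𝓘(ℝ, ℝ), ℝ⟯)
    (e : Fin (n + 1) → Sec m n E), χ x = 1 ∧
      (∀ᶠ y in 𝓝 x, ∀ i, e i y = (trivializationAt (Eucl (n + 1)) E x).localFrame (stdBasis _) i y) ∧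
      ∀ σ : Sec m n E, ∃ f : Fin (n + 1) → C^∞⟮𝓡 m, Q; 𝓘(ℝ, ℝ), ℝ⟯,
        smulSec (χ * χ) σ = ∑ i, smulSec (f i) (e i) := by
  set t := trivializationAt (Eucl (n + 1)) E x with ht
  have hxt : x ∈ t.baseSet := mem_baseSet_trivializationAt ..
  obtain ⟨χ, -, hχ⟩ := (SmoothBumpFunction.nhds_basis_tsupport (I := 𝓡 m) x).mem_iff.1
    (t.open_baseSet.mem_nhds hxt)
  have hχs : ContMDiff (𝓡 m) 𝓘(ℝ, ℝ) ∞ χ := χ.contMDiff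
  have : ContMDiffVectorBundle 1 (Eucl (n + 1)) E (𝓡 m) := .of_le (n := ∞) (by simp)
  refine ⟨⟨χ, hχs⟩, fun i => ⟨fun y => χ y • t.localFrame (stdBasis _) i y, ?_⟩, ?_, ?_, ?_⟩
  · exact ContMDiffOn.smul_section_of_tsupport hχs.contMDiffOn t.open_baseSet hχ
      (t.contMDiffOn_localFrame_baseSet ∞ _ i)
  · exact χ.eq_one
  · filter_upwards [χ.eventuallyEq_one] with y hy i
    change χ y • t.localFrame (stdBasis _) i y = _
    rw [hy, Pi.one_apply, one_smul]
  · intro σ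
    -- One factor χ makes the frame global and another makes the coefficients global, which is why σ
    -- is recovered only after multiplication by χ².
    refine ⟨fun i => ⟨fun y => χ y • t.localFrameCoeff (𝓡 m) (stdBasis _) i y (σ y), ?_⟩, ?_⟩
    · refine contMDiff_of_tsupport fun y hy => ?_
      have hy : y ∈ t.baseSet := hχ (tsupport_smul_subset_left _ _ hy)
      exact hχs.contMDiffAt.smul (contMDiffAt_localFrameCoeff (stdBasis _) hy σ.contMDiff.contMDiffAt i)
    · ext y
      have hsum := t.eq_sum_localFrameCoeff_smul (I := 𝓡 m) (b := stdBasis (n + 1)) (x' := y) (s := σ)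
      rw [sec_sum_apply]
      change (χ y * χ y) • σ y = ∑ i, (χ y • t.localFrameCoeff (𝓡 m) (stdBasis _) i y (σ y)) •
        (χ y • t.localFrame (stdBasis _) i y)
      by_cases hy : y ∈ t.baseSet
      · conv_lhs => rw [hsum hy, Finset.smul_sum]
        refine Finset.sum_congr rfl fun i _ => ?_
        rw [smul_eq_mul]
        module
      · have : χ y = 0 := image_eq_zero_of_notMem_tsupport fun h => hy (hχ h)
        simp [this]

theorem exists_sec_apply_eq [SigmaCompactSpace Q] {x : Q} (a : E x) : ∃ σ : Sec m n E, σ x = a := by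
  obtain ⟨χ, e, -, he, -⟩ := exists_global_frame (m := m) (n := n) (E := E) x
  have : ContMDiffVectorBundle 1 (Eucl (n + 1)) E (𝓡 m) := .of_le (n := ∞) (by simp)
  refine ⟨∑ i, (trivializationAt (Eucl (n + 1)) E x).localFrameCoeff (𝓡 m) (stdBasis _) i x a • e i, ?_⟩
  rw [sec_sum_apply]
  have h := (trivializationAt (Eucl (n + 1)) E x).eq_sum_localFrameCoeff_smul (I := 𝓡 m)
    (b := stdBasis (n + 1)) (x' := x) (s := FiberBundle.extend (Eucl (n + 1)) a)
    (mem_baseSet_trivializationAt ..)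
  rw [FiberBundle.extend_apply_self] at h
  conv_rhs => rw [h]
  refine Finset.sum_congr rfl fun i _ => ?_
  rw [ContMDiffSection.coe_smul, Pi.smul_apply, he.self_of_nhds i]

/-- A functional on sections which vanishes on all `f σ` with `f x = 0` depends only on the value
of a section at `x`. -/
theorem eq_zero_of_apply_eq_zero {x : Q} (ℓ : Sec m n E → ℝ)
    (hadd : ∀ σ τ, ℓ (σ + τ) = ℓ σ + ℓ τ)
    (hℓ : ∀ (f : C^∞⟮𝓡 m, Q; 𝓘(ℝ, ℝ), ℝ⟯) (σ : Sec m n E), f x = 0 → ℓ (smulSec f σ) = 0)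
    (σ : Sec m n E) (hσ : σ x = 0) : ℓ σ = 0 := by
  obtain ⟨χ, e, hχ, he, hf⟩ := exists_global_frame (m := m) (n := n) (E := E) x
  obtain ⟨f, hf⟩ := hf σ
  have hfx (i) : f i x = 0 := by
    have h1 : ∑ i, f i x • e i x = 0 := by
      have := congrArg (fun σ : Sec m n E => σ x) hf
      simp only [sec_sum_apply, smulSec_apply, hσ, smul_zero] at this
      exact this.symm
    have hx := mem_baseSet_trivializationAt (Eucl (n + 1)) E x
    have h2 : LinearIndependent ℝ fun i => e i x := by
      have := ((trivializationAt (Eucl (n + 1)) E x).basisAt (stdBasis (n + 1)) hx).linearIndependent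
      have h3 : (fun i => e i x) =
          (trivializationAt (Eucl (n + 1)) E x).basisAt (stdBasis (n + 1)) hx := by
        funext i
        rw [he.self_of_nhds i, Trivialization.localFrame_apply_of_mem_baseSet _ _ hx]
      rw [h3]
      exact this
    exact Fintype.linearIndependent_iff.1 h2 _ h1 i
  let L : Sec m n E →+ ℝ := AddMonoidHom.mk' ℓ hadd
  -- Every term is a function vanishing at x times a section: χ(x) = 1, and f i (x) = 0 because σ
  -- vanishes at x where the e i are independent.
  have h1 : σ = smulSec (1 - χ * χ) σ + ∑ i, smulSec (f i) (e i) := by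
    rw [← hf]
    ext y
    simp only [ContMDiffSection.coe_add, Pi.add_apply, smulSec_apply, ContMDiffMap.coe_sub,
      Pi.sub_apply, ContMDiffMap.coe_one, Pi.one_apply]
    module
  have h2 : L σ = 0 := by
    have h3 : ∑ i, L (smulSec (f i) (e i)) = 0 := Finset.sum_eq_zero fun i _ => hℓ _ _ (hfx i)
    rw [h1, map_add, map_sum, h3, add_zero]
    refine hℓ _ _ ?_
    simp [hχ]
  exact h2

end Frame

/-! ### Linearity of the derivative in the tangent vector. -/

section DirDeriv

variable {EP : Type*} [NormedAddCommGroup EP] [NormedSpace ℝ EP] {HP : Type*}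
  [TopologicalSpace HP] (J : ModelWithCorners ℝ EP HP) {P : Type*} [TopologicalSpace P]
  [ChartedSpace HP P] (f : P → ℝ) (p : P)

/-- `dirDeriv` as a linear map. -/
def dirDerivL : TangentSpace J p →ₗ[ℝ] ℝ := (mfderiv J 𝓘(ℝ, ℝ) f p).toLinearMap

theorem dirDeriv_vadd (X Y : TangentSpace J p) :
    dirDeriv J f p (X + Y) = dirDeriv J f p X + dirDeriv J f p Y := map_add (dirDerivL J f p) X Y

theorem dirDeriv_vsmul (c : ℝ) (X : TangentSpace J p) :
    dirDeriv J f p (c • X) = c * dirDeriv J f p X := map_smul (dirDerivL J f p) c X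

theorem dirDeriv_vzero : dirDeriv J f p 0 = 0 := map_zero (dirDerivL J f p)

end DirDeriv

/-! ### The canonical form on A⁺ is independent of the chosen extensions. -/

section Liouville

variable {m n : ℕ} {Q : Type*} [TopologicalSpace Q] [ChartedSpace (Eucl m) Q]
  [IsManifold (𝓡 m) ∞ Q]
  {E : Q → Type*} [∀ x, AddCommGroup (E x)] [∀ x, Module ℝ (E x)]
  [∀ x, TopologicalSpace (E x)] [TopologicalSpace (TotalSpace (Eucl (n + 1)) E)]
  [FiberBundle (Eucl (n + 1)) E] [VectorBundle ℝ (Eucl (n + 1)) E]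
  [ContMDiffVectorBundle ∞ (Eucl (n + 1)) E (𝓡 m)]

namespace LieAffgebroid

variable (𝒜 : LieAffgebroid m n E)

/-- The fibrewise linear function `ψ ↦ ψ(σ)` on `A^+`. -/
def evalSec (σ : Sec m n E) (ψ : 𝒜.DualTotal) : ℝ := ψ.2 (σ ψ.proj)

theorem contMDiff_evalSec (σ : Sec m n E) : ContMDiff 𝒜.dualModel 𝓘(ℝ, ℝ) ∞ (𝒜.evalSec σ) := by
  have hproj : ContMDiff 𝒜.dualModel (𝓡 m) ∞ (fun ψ : 𝒜.DualTotal => ψ.proj) :=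
    Bundle.contMDiff_proj _
  have h := ContMDiff.clm_bundle_apply (b := fun ψ : 𝒜.DualTotal => ψ.proj)
    (ϕ := fun ψ : 𝒜.DualTotal => ψ.2) contMDiff_id (σ.contMDiff.comp hproj)
  intro x
  exact ((Bundle.contMDiffAt_totalSpace).1 (h x)).2

theorem mdifferentiableAt_evalSec (σ : Sec m n E) (φ : 𝒜.DualTotal) :
    MDifferentiableAt 𝒜.dualModel 𝓘(ℝ, ℝ) (𝒜.evalSec σ) φ :=
  (𝒜.contMDiff_evalSec σ).mdifferentiableAt (by simp)

theorem dirDeriv_evalSec_add (σ τ : Sec m n E) (φ : 𝒜.DualTotal) (X : TangentSpace 𝒜.dualModel φ) :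
    dirDeriv 𝒜.dualModel (𝒜.evalSec (σ + τ)) φ X =
      dirDeriv 𝒜.dualModel (𝒜.evalSec σ) φ X + dirDeriv 𝒜.dualModel (𝒜.evalSec τ) φ X := by
  have h : 𝒜.evalSec (σ + τ) = 𝒜.evalSec σ + 𝒜.evalSec τ := by
    funext ψ
    exact map_add ψ.2 _ _
  have h2 := mfderiv_add (𝒜.mdifferentiableAt_evalSec σ φ) (𝒜.mdifferentiableAt_evalSec τ φ)
  rw [h]
  exact congrArg (fun f : TangentSpace 𝒜.dualModel φ →L[ℝ] ℝ => f X) h2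

/-- The derivative of `ψ ↦ (fσ)(ψ)` along a tangent vector projecting to `ρ(τ)`. -/
theorem dirDeriv_evalSec_smulSec (f : C^∞⟮𝓡 m, Q; 𝓘(ℝ, ℝ), ℝ⟯) (σ τ : Sec m n E) (φ : 𝒜.DualTotal)
    (X : TangentSpace 𝒜.dualModel φ)
    (hX : mfderiv 𝒜.dualModel (𝓡 m) (TotalSpace.proj : 𝒜.DualTotal → Q) φ X =
      𝒜.anchor φ.proj (τ φ.proj)) :
    dirDeriv 𝒜.dualModel (𝒜.evalSec (smulSec f σ)) φ X =
      f φ.proj * dirDeriv 𝒜.dualModel (𝒜.evalSec σ) φ X +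
        derivAlong 𝒜.anchor τ f φ.proj * 𝒜.evalSec σ φ := by
  have hproj : ContMDiff 𝒜.dualModel (𝓡 m) ∞ (fun ψ : 𝒜.DualTotal => ψ.proj) :=
    Bundle.contMDiff_proj _
  have h : 𝒜.evalSec (smulSec f σ) = (f ∘ TotalSpace.proj) * 𝒜.evalSec σ := by
    funext ψ
    exact map_smul ψ.2 _ _
  have hf : HasMFDerivAt 𝒜.dualModel 𝓘(ℝ, ℝ) (f ∘ (TotalSpace.proj : 𝒜.DualTotal → Q)) φ _ :=
    (mdifferentiableAt_coe f φ.proj).hasMFDerivAt.comp φ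
      (hproj.mdifferentiableAt (x := φ) (by simp)).hasMFDerivAt
  have h2 := (hf.mul (𝒜.mdifferentiableAt_evalSec σ φ).hasMFDerivAt).mfderiv
  rw [h]
  refine (congrArg (fun f : TangentSpace 𝒜.dualModel φ →L[ℝ] ℝ => f X) h2).trans ?_
  change f φ.proj * dirDeriv 𝒜.dualModel (𝒜.evalSec σ) φ X + 𝒜.evalSec σ φ *
    dirDeriv (𝓡 m) f φ.proj (mfderiv 𝒜.dualModel (𝓡 m)
      (TotalSpace.proj : 𝒜.DualTotal → Q) φ X) = _
  rw [hX, mul_comm (𝒜.evalSec σ φ)]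
  rfl

theorem dirDeriv_evalSec_smul (c : ℝ) (σ : Sec m n E) (φ : 𝒜.DualTotal)
    (X : TangentSpace 𝒜.dualModel φ) :
    dirDeriv 𝒜.dualModel (𝒜.evalSec (c • σ)) φ X =
      c * dirDeriv 𝒜.dualModel (𝒜.evalSec σ) φ X := by
  have h : 𝒜.evalSec (c • σ) = c • 𝒜.evalSec σ := by
    funext ψ
    exact map_smul ψ.2 _ _
  have h2 := const_smul_mfderiv (𝒜.mdifferentiableAt_evalSec σ φ) c
  rw [h]
  exact congrArg (fun f : TangentSpace 𝒜.dualModel φ →L[ℝ] ℝ => f X) h2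

variable [T2Space Q] [SigmaCompactSpace Q]

theorem negDLiouville_def (φ : 𝒜.DualTotal) (σ τ : Sec m n E) (X Y : TangentSpace 𝒜.dualModel φ) :
    𝒜.negDLiouville φ σ τ X Y = -(dirDeriv 𝒜.dualModel (𝒜.evalSec τ) φ X -
      dirDeriv 𝒜.dualModel (𝒜.evalSec σ) φ Y - 𝒜.evalSec (𝒜.bracket σ τ) φ) := rfl

theorem evalSec_add (σ τ : Sec m n E) (φ : 𝒜.DualTotal) :
    𝒜.evalSec (σ + τ) φ = 𝒜.evalSec σ φ + 𝒜.evalSec τ φ := map_add φ.2 _ _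

theorem evalSec_neg (σ : Sec m n E) (φ : 𝒜.DualTotal) :
    𝒜.evalSec (-σ) φ = -𝒜.evalSec σ φ := map_neg φ.2 _

theorem evalSec_sub (σ τ : Sec m n E) (φ : 𝒜.DualTotal) :
    𝒜.evalSec (σ - τ) φ = 𝒜.evalSec σ φ - 𝒜.evalSec τ φ := map_sub φ.2 _ _

theorem evalSec_smul (c : ℝ) (σ : Sec m n E) (φ : 𝒜.DualTotal) :
    𝒜.evalSec (c • σ) φ = c * 𝒜.evalSec σ φ := map_smul φ.2 _ _

theorem evalSec_smulSec (f : C^∞⟮𝓡 m, Q; 𝓘(ℝ, ℝ), ℝ⟯) (σ : Sec m n E) (φ : 𝒜.DualTotal) :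
    𝒜.evalSec (smulSec f σ) φ = f φ.proj * 𝒜.evalSec σ φ := map_smul φ.2 _ _

theorem negDLiouville_antisymm (φ : 𝒜.DualTotal) (σ τ : Sec m n E)
    (X Y : TangentSpace 𝒜.dualModel φ) :
    𝒜.negDLiouville φ σ τ X Y = -𝒜.negDLiouville φ τ σ Y X := by
  rw [negDLiouville_def, negDLiouville_def, bracket_antisymm, evalSec_neg]
  ring

theorem negDLiouville_add_left (φ : 𝒜.DualTotal) (σ σ' τ : Sec m n E)
    (X X' Y : TangentSpace 𝒜.dualModel φ) :
    𝒜.negDLiouville φ (σ + σ') τ (X + X') Y =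
      𝒜.negDLiouville φ σ τ X Y + 𝒜.negDLiouville φ σ' τ X' Y := by
  rw [negDLiouville_def, negDLiouville_def, negDLiouville_def, bracket_add_left, evalSec_add,
    dirDeriv_evalSec_add, dirDeriv_vadd]
  ring

theorem negDLiouville_smul_left (c : ℝ) (φ : 𝒜.DualTotal) (σ τ : Sec m n E)
    (X Y : TangentSpace 𝒜.dualModel φ) :
    𝒜.negDLiouville φ (c • σ) τ (c • X) Y = c * 𝒜.negDLiouville φ σ τ X Y := by
  rw [negDLiouville_def, negDLiouville_def, bracket_smul_left, evalSec_smul,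
    dirDeriv_evalSec_smul, dirDeriv_vsmul]
  ring

/-- `negDLiouville` depends on the first section only through its value at the base point. -/
theorem negDLiouville_eq_zero (φ : 𝒜.DualTotal) (σ τ : Sec m n E) (Y : TangentSpace 𝒜.dualModel φ)
    (hY : mfderiv 𝒜.dualModel (𝓡 m) (TotalSpace.proj : 𝒜.DualTotal → Q) φ Y =
      𝒜.anchor φ.proj (τ φ.proj)) (hσ : σ φ.proj = 0) : 𝒜.negDLiouville φ σ τ 0 Y = 0 := by
  refine eq_zero_of_apply_eq_zero (fun σ => 𝒜.negDLiouville φ σ τ 0 Y) (fun σ σ' => ?_)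
    (fun f σ hf => ?_) σ hσ
  · rw [← negDLiouville_add_left, add_zero]
  -- Y projects to ρ(τ), so the derivative of ψ ↦ ψ(fσ) along Y contributes ρ(τ)(f) φ(σ). The
  -- Leibniz term of the bracket contributes the opposite, and the rest carries the factor f, which
  -- is zero at the base point.
  · rw [negDLiouville_def, bracket_smulSec_left, evalSec_sub, evalSec_smulSec, evalSec_smulSec,
      𝒜.dirDeriv_evalSec_smulSec f σ τ φ Y hY, hf, dirDeriv_vzero]
    ring

theorem extend_apply {x : Q} (a : E x) : (extend a : Sec m n E) x = a :=
  Classical.epsilon_spec (exists_sec_apply_eq a)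

/-- The canonical form can be computed with any extensions. -/
theorem canonicalForm_eq (φ : 𝒜.DualTotal) (z w : E φ.proj × TangentSpace 𝒜.dualModel φ)
    (hz : z ∈ 𝒜.prolong 𝒜.dualModel (TotalSpace.proj : 𝒜.DualTotal → Q) φ)
    (hw : w ∈ 𝒜.prolong 𝒜.dualModel (TotalSpace.proj : 𝒜.DualTotal → Q) φ)
    (σ τ : Sec m n E) (hσ : σ φ.proj = z.1) (hτ : τ φ.proj = w.1) :
    𝒜.canonicalForm φ z w = 𝒜.negDLiouville φ σ τ z.2 w.2 := by
  have key (σ σ' τ : Sec m n E) (X Y : TangentSpace 𝒜.dualModel φ)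
      (hY : mfderiv 𝒜.dualModel (𝓡 m) (TotalSpace.proj : 𝒜.DualTotal → Q) φ Y =
        𝒜.anchor φ.proj (τ φ.proj)) (hσ : σ φ.proj = σ' φ.proj) :
      𝒜.negDLiouville φ σ τ X Y = 𝒜.negDLiouville φ σ' τ X Y := by
    have h0 : (σ - σ') φ.proj = 0 := sub_eq_zero.2 hσ
    have h1 := 𝒜.negDLiouville_add_left φ (σ - σ') σ' τ 0 X Y
    rwa [𝒜.negDLiouville_eq_zero φ _ τ Y hY h0, zero_add, zero_add, sub_add_cancel] at h1
  have hz : 𝒜.anchor φ.proj z.1 = _ := hz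
  have hw : 𝒜.anchor φ.proj w.1 = _ := hw
  -- The first extension is replaced directly, the second after exchanging the arguments by
  -- antisymmetry.
  rw [canonicalForm, key _ σ _ _ _ (by rw [extend_apply, hw]) (by rw [extend_apply, hσ]),
    negDLiouville_antisymm, key _ τ _ _ _ (by rw [hσ, hz]) (by rw [extend_apply, hτ]),
    ← negDLiouville_antisymm]

end LieAffgebroid
end Liouville

/-! ### Bundle projections are submersions; dimensions of fibres. -/

section BundleProjection

variable {EB : Type*} [NormedAddCommGroup EB] [NormedSpace ℝ EB] {HB : Type*} [TopologicalSpace HB]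
  (IB : ModelWithCorners ℝ EB HB) {B : Type*} [TopologicalSpace B] [ChartedSpace HB B]
  [IsManifold IB ∞ B] (F : Type*) [NormedAddCommGroup F] [NormedSpace ℝ F]
  {V : B → Type*} [TopologicalSpace (TotalSpace F V)] [∀ x, AddCommGroup (V x)]
  [∀ x, Module ℝ (V x)] [∀ x, TopologicalSpace (V x)] [FiberBundle F V] [VectorBundle ℝ F V]
  [ContMDiffVectorBundle ∞ F V IB]

/-- A local section through v, smooth at its base point, differentiates to a right inverse. -/
theorem mfderiv_proj_surjective (v : TotalSpace F V) : Function.Surjective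
    (mfderiv (IB.prod 𝓘(ℝ, F)) IB (TotalSpace.proj : TotalSpace F V → B) v) := by
  obtain ⟨x, a⟩ := v
  set s : B → TotalSpace F V := fun y => ⟨y, FiberBundle.extend F a y⟩ with hs
  have hsx : s x = ⟨x, a⟩ := by simp [hs]
  have h1 : MDifferentiableAt IB (IB.prod 𝓘(ℝ, F)) s x :=
    (FiberBundle.contMDiffAt_extend IB F (k := ∞) a).mdifferentiableAt (by simp)
  have h2 : MDifferentiableAt (IB.prod 𝓘(ℝ, F)) IB (TotalSpace.proj : TotalSpace F V → B) (s x) :=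
    (Bundle.contMDiff_proj V (n := ∞)).mdifferentiableAt (by simp)
  have h3 := mfderiv_comp x h2 h1
  rw [← hsx]
  intro X
  refine ⟨mfderiv IB (IB.prod 𝓘(ℝ, F)) s x X, ?_⟩
  have h4 := congrArg (fun A : TangentSpace IB x →L[ℝ] TangentSpace IB x => A X) h3
  refine h4.symm.trans ?_
  change mfderiv IB IB id x X = X
  rw [mfderiv_id]
  rfl

theorem finiteDimensional_fiber [FiniteDimensional ℝ F] (x : B) : FiniteDimensional ℝ (V x) :=
  ((trivializationAt F V x).linearEquivAt ℝ x
    (mem_baseSet_trivializationAt F V x)).symm.finiteDimensional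

theorem finrank_fiber (x : B) : Module.finrank ℝ (V x) = Module.finrank ℝ F :=
  ((trivializationAt F V x).linearEquivAt ℝ x
    (mem_baseSet_trivializationAt F V x)).finrank_eq

end BundleProjection

/-! ### The forms as bilinear maps on the prolongations, and the rank bound for Ω_{W₀}. -/

section Forms

variable {m n : ℕ} {Q : Type*} [TopologicalSpace Q] [ChartedSpace (Eucl m) Q]
  [IsManifold (𝓡 m) ∞ Q] [T2Space Q] [SigmaCompactSpace Q]
  {E : Q → Type*} [∀ x, AddCommGroup (E x)] [∀ x, Module ℝ (E x)]
  [∀ x, TopologicalSpace (E x)] [TopologicalSpace (TotalSpace (Eucl (n + 1)) E)]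
  [FiberBundle (Eucl (n + 1)) E] [VectorBundle ℝ (Eucl (n + 1)) E]
  [ContMDiffVectorBundle ∞ (Eucl (n + 1)) E (𝓡 m)]

namespace LieAffgebroid

variable (𝒜 : LieAffgebroid m n E)

/-- The fibre of the prolongation `𝒯^Ã A^+`. -/
abbrev dualProlong (φ : 𝒜.DualTotal) :=
  𝒜.prolong 𝒜.dualModel (TotalSpace.proj : 𝒜.DualTotal → Q) φ

/-- The fibre is the kernel of (a, X) ↦ ρ(a) - Tpr(X), which is onto because pr is a submersion: (n
+ 1) + (m + n + 1) - m = 2n + 2. -/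
theorem finrank_dualProlong (φ : 𝒜.DualTotal) :
    Module.finrank ℝ (𝒜.dualProlong φ) = 2 * n + 2 := by
  have hE : FiniteDimensional ℝ (E φ.proj) := finiteDimensional_fiber (Eucl (n + 1)) φ.proj
  have hT : FiniteDimensional ℝ (TangentSpace 𝒜.dualModel φ) :=
    inferInstanceAs (FiniteDimensional ℝ (Eucl m × (Eucl (n + 1) →L[ℝ] ℝ)))
  have hQ : FiniteDimensional ℝ (TangentSpace (𝓡 m) φ.proj) :=
    inferInstanceAs (FiniteDimensional ℝ (Eucl m))
  have hdE : Module.finrank ℝ (E φ.proj) = n + 1 :=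
    (finrank_fiber (Eucl (n + 1)) φ.proj).trans finrank_euclideanSpace_fin
  have hdT : Module.finrank ℝ (TangentSpace 𝒜.dualModel φ) = m + (n + 1) := by
    change Module.finrank ℝ (Eucl m × (Eucl (n + 1) →L[ℝ] ℝ)) = m + (n + 1)
    rw [Module.finrank_prod, finrank_continuousDual, finrank_euclideanSpace_fin,
      finrank_euclideanSpace_fin]
  have hdQ : Module.finrank ℝ (TangentSpace (𝓡 m) φ.proj) = m :=
    finrank_euclideanSpace_fin
  let Tp := mfderiv 𝒜.dualModel (𝓡 m) (TotalSpace.proj : 𝒜.DualTotal → Q) φ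
  let δ : E φ.proj × TangentSpace 𝒜.dualModel φ →ₗ[ℝ] TangentSpace (𝓡 m) φ.proj :=
    (𝒜.anchor φ.proj).toLinearMap.comp (LinearMap.fst ℝ _ _) -
      Tp.toLinearMap.comp (LinearMap.snd ℝ _ _)
  have hker : LinearMap.ker δ = 𝒜.dualProlong φ := by
    ext z
    exact sub_eq_zero
  have hsurj : Function.Surjective δ := by
    intro X
    obtain ⟨Y, hY⟩ := mfderiv_proj_surjective (𝓡 m) (Eucl (n + 1) →L[ℝ] ℝ) φ (-X)
    refine ⟨(0, Y), ?_⟩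
    change 𝒜.anchor φ.proj 0 - Tp Y = X
    rw [map_zero, zero_sub, hY, neg_neg]
  have h := δ.finrank_range_add_finrank_ker
  rw [LinearMap.range_eq_top.2 hsurj, finrank_top, Module.finrank_prod, hdE, hdT, hdQ, hker] at h
  omega

/-- `canonicalForm` as a bilinear form on the prolongation. -/
def canonicalFormL (φ : 𝒜.DualTotal) : 𝒜.dualProlong φ →ₗ[ℝ] 𝒜.dualProlong φ →ₗ[ℝ] ℝ :=
  have hskew (z w : 𝒜.dualProlong φ) : 𝒜.canonicalForm φ z w = -𝒜.canonicalForm φ w z :=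
    𝒜.negDLiouville_antisymm ..
  have hadd (z z' w : 𝒜.dualProlong φ) : 𝒜.canonicalForm φ (z + z') w =
      𝒜.canonicalForm φ z w + 𝒜.canonicalForm φ z' w := by
    -- The choice of extensions is not additive, but the sum of the chosen extensions is an
    -- admissible extension of the sum.
    rw [𝒜.canonicalForm_eq φ (z + z') w (add_mem z.2 z'.2) w.2 (extend z.1.1 + extend z'.1.1)
      (extend w.1.1) ?_ (extend_apply _)]
    · exact 𝒜.negDLiouville_add_left ..
    · rw [ContMDiffSection.coe_add, Pi.add_apply, extend_apply, extend_apply]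
      rfl
  have hsmul (c : ℝ) (z w : 𝒜.dualProlong φ) : 𝒜.canonicalForm φ (c • z) w =
      c * 𝒜.canonicalForm φ z w := by
    rw [𝒜.canonicalForm_eq φ (c • z) w (Submodule.smul_mem _ c z.2) w.2 (c • extend z.1.1)
      (extend w.1.1) ?_ (extend_apply _)]
    · exact 𝒜.negDLiouville_smul_left ..
    · rw [ContMDiffSection.coe_smul, Pi.smul_apply, extend_apply]
      rfl
  LinearMap.mk₂ ℝ (fun z w => 𝒜.canonicalForm φ z w) hadd hsmul
    (fun z w w' => by
      have := hadd w w' z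
      rw [hskew z, hskew z w]
      change -𝒜.canonicalForm φ (w + w') z = _
      rw [this, hskew z w']
      ring)
    (fun c z w => by
      have := hsmul c w z
      rw [hskew z, hskew z w]
      change -𝒜.canonicalForm φ (c • w) z = _
      rw [this]
      simp)

theorem canonicalFormL_skew (φ : 𝒜.DualTotal) (z w : 𝒜.dualProlong φ) :
    𝒜.canonicalFormL φ z w = -𝒜.canonicalFormL φ w z := 𝒜.negDLiouville_antisymm ..

section Prolongation

variable {EP : Type*} [NormedAddCommGroup EP] [NormedSpace ℝ EP] {HP : Type*} [TopologicalSpace HP]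
  {J : ModelWithCorners ℝ EP HP} {P : Type*} [TopologicalSpace P] [ChartedSpace HP P]
  {EP' : Type*} [NormedAddCommGroup EP'] [NormedSpace ℝ EP'] {HP' : Type*} [TopologicalSpace HP']
  {J' : ModelWithCorners ℝ EP' HP'} {P' : Type*} [TopologicalSpace P'] [ChartedSpace HP' P']

variable [IsManifold J ∞ P] [IsManifold J' ∞ P']

/-- The map `(Id, TΦ)` between prolongations. -/
def prolongMap (pr : P' → Q) (Φ : P → P') (p : P) (hpr : MDifferentiableAt J' (𝓡 m) pr (Φ p))
    (hΦ : MDifferentiableAt J J' Φ p) :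
    𝒜.prolong J (fun p => pr (Φ p)) p →ₗ[ℝ] 𝒜.prolong J' pr (Φ p) :=
  LinearMap.codRestrict _
    ((LinearMap.id.prodMap (mfderiv J J' Φ p).toLinearMap).comp (Submodule.subtype _)) fun z => by
      have h1 : 𝒜.anchor (pr (Φ p)) z.1.1 = mfderiv J (𝓡 m) (pr ∘ Φ) p z.1.2 := z.2
      rw [mfderiv_comp p hpr hΦ] at h1
      exact h1

end Prolongation

section Vakonomic

variable {𝒜} {d : ℕ} {M : Set (TotalSpace (Eucl (n + 1)) E)} [ChartedSpace (Eucl d) M]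
  [IsManifold (𝓡 d) ∞ M] (hM : 𝒜.IsConstraintSubmanifold d M)

theorem contMDiff_π₁ : ContMDiff (W₀model hM) 𝒜.dualModel ∞ (π₁ hM) := by
  intro w
  refine Bundle.contMDiffAt_totalSpace.2 ⟨?_, ?_⟩
  · exact (hM.τ.contMDiff.comp (Bundle.contMDiff_proj _)) w
  · exact (Bundle.contMDiffAt_totalSpace.1 (contMDiffAt_id (I := W₀model hM) (x := w))).2

theorem contMDiff_ν : ContMDiff (W₀model hM) (𝓡 m) ∞ (ν hM) :=
  hM.τ.contMDiff.comp (Bundle.contMDiff_proj _)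

/-- The fibre of the prolongation `𝒯^Ã W₀`. -/
abbrev prolongW₀ (w : W₀ hM) := 𝒜.prolong (W₀model hM) (ν hM) w

/-- The map `(Id, Tπ₁) : 𝒯^Ã W₀ → 𝒯^Ã A^+`. -/
def prolongπ₁ (w : W₀ hM) : prolongW₀ hM w →ₗ[ℝ] 𝒜.dualProlong (π₁ hM w) :=
  𝒜.prolongMap TotalSpace.proj (π₁ hM) w
    ((Bundle.contMDiff_proj _ (n := ∞)).mdifferentiableAt (by simp))
    ((contMDiff_π₁ hM).mdifferentiableAt (by simp))

/-- `eta` as a linear form on the prolongation. -/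
def etaL (w : W₀ hM) : prolongW₀ hM w →ₗ[ℝ] ℝ :=
  (𝒜.one (ν hM w)).toLinearMap.comp ((LinearMap.fst ℝ _ _).comp (Submodule.subtype _))

/-- `dPontryagin` as a linear form on the prolongation. -/
def dPontryaginL (L : TotalSpace (Eucl (n + 1)) E → ℝ) (w : W₀ hM) : prolongW₀ hM w →ₗ[ℝ] ℝ :=
  (dirDerivL (W₀model hM) (pontryagin hM L) w).comp
    ((LinearMap.snd ℝ _ _).comp (Submodule.subtype _))

/-- `OmegaW₀` as a bilinear form on the prolongation. -/
def OmegaW₀L (L : TotalSpace (Eucl (n + 1)) E → ℝ) (w : W₀ hM) :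
    prolongW₀ hM w →ₗ[ℝ] prolongW₀ hM w →ₗ[ℝ] ℝ :=
  (𝒜.canonicalFormL (π₁ hM w)).compl₁₂ (prolongπ₁ hM w) (prolongπ₁ hM w) +
    ((dPontryaginL hM L w).smulRight (etaL hM w) - (etaL hM w).smulRight (dPontryaginL hM L w))

variable (L : TotalSpace (Eucl (n + 1)) E → ℝ)

theorem OmegaW₀L_def (w : W₀ hM) (z z' : prolongW₀ hM w) :
    OmegaW₀L hM L w z z' = 𝒜.canonicalFormL (π₁ hM w) (prolongπ₁ hM w z) (prolongπ₁ hM w z') +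
      (dPontryaginL hM L w z * etaL hM w z' - etaL hM w z * dPontryaginL hM L w z') := rfl

theorem OmegaW₀L_apply (w : W₀ hM) (z z' : prolongW₀ hM w) :
    OmegaW₀L hM L w z z' = OmegaW₀ hM L w z z' := by
  rw [OmegaW₀L_def, mul_comm (etaL hM w z)]
  rfl

theorem OmegaW₀L_skew (w : W₀ hM) (z z' : prolongW₀ hM w) :
    OmegaW₀L hM L w z z' = -OmegaW₀L hM L w z' z := by
  have h := 𝒜.canonicalFormL_skew (π₁ hM w) (prolongπ₁ hM w z) (prolongπ₁ hM w z')
  have h1 := OmegaW₀L_def hM L w z z'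
  have h2 := OmegaW₀L_def hM L w z' z
  linarith

theorem etaL_of_prolongπ₁_eq_zero (w : W₀ hM) (v : prolongW₀ hM w)
    (hv : prolongπ₁ hM w v = 0) : etaL hM w v = 0 := by
  have h1 : v.1.1 = 0 := congrArg (fun z : 𝒜.dualProlong (π₁ hM w) => z.1.1) hv
  exact (congrArg (𝒜.one (ν hM w)) h1).trans (map_zero (𝒜.one (ν hM w)))

/-- The pulled back canonical form kills v, and so does η, which sees only the Ã-component; just one
half of dH ∧ η is left. -/
theorem OmegaW₀L_of_prolongπ₁_eq_zero (w : W₀ hM) (v z : prolongW₀ hM w)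
    (hv : prolongπ₁ hM w v = 0) : OmegaW₀L hM L w v z = dPontryaginL hM L w v * etaL hM w z := by
  have hη := etaL_of_prolongπ₁_eq_zero hM w v hv
  have hΩ : 𝒜.canonicalFormL (π₁ hM w) (prolongπ₁ hM w v) (prolongπ₁ hM w z) = 0 := by
    exact LinearMap.congr_fun ((congrArg (𝒜.canonicalFormL (π₁ hM w)) hv).trans
      (LinearMap.map_zero _)) _
  have h := OmegaW₀L_def hM L w v z
  have h1 : etaL hM w v * dPontryaginL hM L w z = 0 := mul_eq_zero_of_left hη _
  linarith

theorem finiteDimensional_prolongW₀ (w : W₀ hM) : FiniteDimensional ℝ (prolongW₀ hM w) := by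
  have hE : FiniteDimensional ℝ (E (ν hM w)) := finiteDimensional_fiber (Eucl (n + 1)) (ν hM w)
  have hT : FiniteDimensional ℝ (TangentSpace (W₀model hM) w) :=
    inferInstanceAs (FiniteDimensional ℝ (Eucl d × (Eucl (n + 1) →L[ℝ] ℝ)))
  infer_instance

/-- The strictness gains one dimension, lowering the bound on the rank of Ω_{W₀} from 2n + 2 to 2n +
1. -/
theorem ker_prolongπ₁_lt {w : W₀ hM} (hw : w ∈ W₁ hM L) :
    LinearMap.ker (prolongπ₁ hM w) < LinearMap.ker (OmegaW₀L hM L w) := by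
  obtain ⟨Z, hZ, hΩZ, hηZ⟩ := hw
  obtain ⟨Z', hZ'⟩ : ∃ Z' : prolongW₀ hM w, Z'.1 = Z := ⟨⟨Z, hZ⟩, rfl⟩
  have hΩZ' (z) : OmegaW₀L hM L w Z' z = 0 := by
    rw [OmegaW₀L_apply, hZ']
    exact hΩZ z z.2
  have hηZ' : etaL hM w Z' = 1 := by
    rw [← hηZ, ← hZ']
    rfl
  refine lt_of_le_of_ne (fun v hv => ?_) fun h => ?_
  · have h1 := OmegaW₀L_of_prolongπ₁_eq_zero hM L w v Z' hv
    have h2 := OmegaW₀L_skew hM L w v Z'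
    have h3 := hΩZ' v
    -- Pair v with Z: the result is dH(v) η(Z) = dH(v) on one side and -Ω_{W₀}(Z, v) = 0 on the
    -- other.
    have h4 : dPontryaginL hM L w v = 0 := by
      have h5 : dPontryaginL hM L w v * etaL hM w Z' = dPontryaginL hM L w v :=
        (congrArg (dPontryaginL hM L w v * ·) hηZ').trans (mul_one _)
      linarith
    exact LinearMap.ext fun z =>
      (OmegaW₀L_of_prolongπ₁_eq_zero hM L w v z hv).trans (mul_eq_zero_of_left h4 _)
  · have h1 : Z' ∈ LinearMap.ker (OmegaW₀L hM L w) := LinearMap.ext hΩZ'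
    rw [← h] at h1
    exact zero_ne_one ((etaL_of_prolongπ₁_eq_zero hM w Z' h1).symm.trans hηZ')

/-- At the points of `W₁` the rank of `Ω_{W₀}` is at most `2n + 1`. -/
theorem finrank_prolongW₀_le {w : W₀ hM} (hw : w ∈ W₁ hM L) :
    Module.finrank ℝ (prolongW₀ hM w) ≤
      2 * n + 1 + Module.finrank ℝ (LinearMap.ker (OmegaW₀L hM L w)) := by
  have := finiteDimensional_prolongW₀ hM w
  have h1 := Submodule.finrank_lt_finrank_of_lt (ker_prolongπ₁_lt hM L hw)
  have h2 := (prolongπ₁ hM w).finrank_range_add_finrank_ker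
  have h3 := 𝒜.finrank_dualProlong (π₁ hM w)
  have h4 : FiniteDimensional ℝ (𝒜.dualProlong (π₁ hM w)) := .of_finrank_pos (by omega)
  have h5 := Submodule.finrank_le (LinearMap.range (prolongπ₁ hM w))
  omega

section Restriction

variable (k : ℕ) [ChartedSpace (Eucl k) (W₁' hM L)] [IsManifold (𝓡 k) ∞ (W₁' hM L)]

/-- The fibre of the prolongation `𝒯^Ã W₁'`. -/
abbrev prolongW₁' (w : W₁' hM L) := 𝒜.prolong (𝓡 k) (ν₁' hM L) w

variable (hW : ContMDiff (𝓡 k) (W₀model hM) ∞ (Subtype.val : W₁' hM L → W₀ hM))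

/-- The inclusion `𝒯^Ã W₁' → 𝒯^Ã W₀` as a linear map. -/
def inclL (w : W₁' hM L) : prolongW₁' hM L k w →ₗ[ℝ] prolongW₀ hM w.1 :=
  𝒜.prolongMap (ν hM) Subtype.val w ((contMDiff_ν hM).mdifferentiableAt (by simp))
    (hW.mdifferentiableAt (by simp))

/-- `OmegaW₁'` as a bilinear form on the prolongation. -/
def OmegaW₁'L (w : W₁' hM L) : prolongW₁' hM L k w →ₗ[ℝ] prolongW₁' hM L k w →ₗ[ℝ] ℝ :=
  (OmegaW₀L hM L w.1).compl₁₂ (inclL hM L k hW w) (inclL hM L k hW w)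

/-- `etaW₁'` as a linear form on the prolongation. -/
def etaW₁'L (w : W₁' hM L) : prolongW₁' hM L k w →ₗ[ℝ] ℝ :=
  (etaL hM w.1).comp (inclL hM L k hW w)

theorem OmegaW₁'L_apply (w : W₁' hM L) (z z' : prolongW₁' hM L k w) :
    OmegaW₁'L hM L k hW w z z' = OmegaW₁' hM L k w z z' := OmegaW₀L_apply ..

theorem etaW₁'L_apply (w : W₁' hM L) (z : prolongW₁' hM L k w) :
    etaW₁'L hM L k hW w z = etaW₁' hM L k w z := rfl

theorem OmegaW₁'L_skew (w : W₁' hM L) (z z' : prolongW₁' hM L k w) :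
    OmegaW₁'L hM L k hW w z z' = -OmegaW₁'L hM L k hW w z' z := OmegaW₀L_skew ..

/-- The nonvanishing of η ∧ Ωⁿ enters the argument in this form: ker Ω ∩ ker η = 0 on each fibre
over W₁'. -/
theorem eq_zero_of_OmegaW₁'L_of_etaW₁'L
    (hcos : 𝒜.IsCosymplectic (𝓡 k) (ν₁' hM L) n (OmegaW₁' hM L k) (etaW₁' hM L k))
    (w : W₁' hM L) (v : prolongW₁' hM L k w)
    (hv : ∀ u, OmegaW₁'L hM L k hW w v u = 0) (hηv : etaW₁'L hM L k hW w v = 0) : v = 0 := by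
  obtain ⟨z, hz, hne⟩ := hcos.nondegenerate w
  refine eq_zero_of_wedgeTop_ne_zero (hcos.rank w) _ _ (OmegaW₁'L_skew hM L k hW w)
    (fun i => ⟨z i, hz i⟩) ?_ v hv hηv
  convert hne using 1
  simp only [wedgeTop, OmegaW₁'L_apply, etaW₁'L_apply]

theorem exists_reebW₁'
    (hcos : 𝒜.IsCosymplectic (𝓡 k) (ν₁' hM L) n (OmegaW₁' hM L k) (etaW₁' hM L k))
    (w : W₁' hM L) : ∃ v : prolongW₁' hM L k w,
    (∀ u, OmegaW₁'L hM L k hW w v u = 0) ∧ etaW₁'L hM L k hW w v = 1 :=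
  exists_reeb_vector (hcos.rank w) _ _ (OmegaW₁'L_skew hM L k hW w)
    (eq_zero_of_OmegaW₁'L_of_etaW₁'L hM L k hW hcos w)

/-- The Reeb vector of `(Ω_{W₁'}, η_{W₁'})` lies in the kernel of `Ω_{W₀}`. -/
theorem OmegaW₀L_inclL_eq_zero
    (hcos : 𝒜.IsCosymplectic (𝓡 k) (ν₁' hM L) n (OmegaW₁' hM L k) (etaW₁' hM L k))
    (w : W₁' hM L) (v : prolongW₁' hM L k w)
    (hv : ∀ u, OmegaW₁'L hM L k hW w v u = 0) (hηv : etaW₁'L hM L k hW w v = 1) :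
    OmegaW₀L hM L w.1 (inclL hM L k hW w v) = 0 := by
  have := finiteDimensional_prolongW₀ hM w.1
  refine apply_eq_zero_of_finrank_le (inclL hM L k hW w) ?_ _ (OmegaW₀L_skew hM L w.1) v hv ?_ ?_
  -- Injectivity also comes from nondegeneracy: both restricted forms factor through the inclusion,
  -- so a vector it kills lies in both kernels.
  · rw [injective_iff_map_eq_zero]
    intro z hz
    refine eq_zero_of_OmegaW₁'L_of_etaW₁'L hM L k hW hcos w z (fun u => ?_) ?_
    · exact LinearMap.congr_fun ((congrArg (OmegaW₀L hM L w.1) hz).trans (LinearMap.map_zero _)) _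
    · exact (congrArg (etaL hM w.1) hz).trans (LinearMap.map_zero _)
  · intro s hs
    -- If s is in the kernel of the restricted form, then s - η(s) v is in both kernels.
    refine ⟨etaW₁'L hM L k hW w s, sub_eq_zero.1 ?_⟩
    refine eq_zero_of_OmegaW₁'L_of_etaW₁'L hM L k hW hcos w _ (fun u => ?_) ?_
    · have h1 : OmegaW₁'L hM L k hW w s u = 0 := hs u
      rw [map_sub, map_smul, LinearMap.sub_apply, LinearMap.smul_apply, hv, h1, smul_zero, sub_zero]
    · rw [map_sub, map_smul, hηv, smul_eq_mul, mul_one, sub_self]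
  · rw [hcos.rank w]
    exact finrank_prolongW₀_le hM L w.2.1

end Restriction
end Vakonomic
end LieAffgebroid
end Forms

/-! ### Smoothness of Reeb sections in local frames. -/

section Smoothness

variable {m n : ℕ} {Q : Type*} [TopologicalSpace Q] [ChartedSpace (Eucl m) Q]
  [IsManifold (𝓡 m) ∞ Q] [T2Space Q] [SigmaCompactSpace Q]
  {E : Q → Type*} [∀ x, AddCommGroup (E x)] [∀ x, Module ℝ (E x)]
  [∀ x, TopologicalSpace (E x)] [TopologicalSpace (TotalSpace (Eucl (n + 1)) E)]
  [FiberBundle (Eucl (n + 1)) E] [VectorBundle ℝ (Eucl (n + 1)) E]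
  [ContMDiffVectorBundle ∞ (Eucl (n + 1)) E (𝓡 m)]
  {EP : Type*} [NormedAddCommGroup EP] [NormedSpace ℝ EP] [FiniteDimensional ℝ EP]
  {HP : Type*} [TopologicalSpace HP]
  {J : ModelWithCorners ℝ EP HP} {P : Type*} [TopologicalSpace P] [ChartedSpace HP P]
  [IsManifold J ∞ P]

variable (m n E J) in
/-- Sections of `E` and local vector fields on `P` which together form a frame of
`pr^* E ⊕ TP` near a point. -/
theorem exists_sum_frame (pr : P → Q) (hpr : Continuous pr) (p : P) :
    ∃ (σ : Fin (n + 1) ⊕ Fin (Module.finrank ℝ EP) → Sec m n E)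
      (X : Fin (n + 1) ⊕ Fin (Module.finrank ℝ EP) → ∀ q : P, TangentSpace J q),
      (∀ A, ContMDiffAt J J.tangent ∞ (fun q => (⟨q, X A q⟩ : TangentBundle J P)) p) ∧
      ∀ᶠ q in 𝓝 p, Function.Bijective
        (fun u : Fin (n + 1) ⊕ Fin (Module.finrank ℝ EP) → ℝ =>
          ((∑ A, u A • σ A (pr q), ∑ A, u A • X A q) : E (pr q) × TangentSpace J q)) := by
  obtain ⟨χ, e, -, he, -⟩ := exists_global_frame (m := m) (n := n) (E := E) (pr p)
  set tE := trivializationAt (Eucl (n + 1)) E (pr p)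
  set tP := trivializationAt EP (TangentSpace J : P → Type _) p
  have hp : p ∈ tP.baseSet := mem_baseSet_trivializationAt ..
  have hprp : pr p ∈ tE.baseSet := mem_baseSet_trivializationAt ..
  let b := Module.finBasis ℝ EP
  -- The frame is split: sections of E paired with the zero field, and a local frame of the tangent
  -- bundle paired with the zero section. Its members need not belong to the prolongation.
  refine ⟨Sum.elim e fun _ => 0, Sum.elim (fun _ _ => 0) (tP.localFrame b), ?_, ?_⟩
  · rintro (i | j)
    · exact (contMDiff_zeroSection ℝ (TangentSpace J : P → Type _)).contMDiffAt
    · exact contMDiffAt_localFrame_of_mem ∞ tP b j hp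
  · filter_upwards [hpr.continuousAt.eventually he, tP.open_baseSet.mem_nhds hp,
      hpr.continuousAt.preimage_mem_nhds (tE.open_baseSet.mem_nhds hprp)] with q hq hqP hqE
    have hq' (i) : e i (pr q) = tE.basisAt (stdBasis (n + 1)) hqE i :=
      (hq i).trans (tE.localFrame_apply_of_mem_baseSet _ hqE)
    have h : (fun u : Fin (n + 1) ⊕ Fin (Module.finrank ℝ EP) → ℝ =>
        ((∑ A, u A • (Sum.elim e (fun _ => 0) A : Sec m n E) (pr q),
          ∑ A, u A • (Sum.elim (fun _ _ => 0) (tP.localFrame b) A :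
            ∀ q : P, TangentSpace J q) q) : E (pr q) × TangentSpace J q)) =
        ((tE.basisAt (stdBasis (n + 1)) hqE).prod (tP.basisAt b hqP)).equivFun.symm := by
      funext u
      rw [Module.Basis.equivFun_symm_apply]
      refine Prod.ext ?_ ?_
      · rw [Prod.fst_sum, Fintype.sum_sum_type, Fintype.sum_sum_type]
        simp [Module.Basis.prod_apply, hq']
      · rw [Prod.snd_sum, Fintype.sum_sum_type, Fintype.sum_sum_type]
        simp [Module.Basis.prod_apply, hqP]
    rw [h]
    exact LinearEquiv.bijective _

theorem contMDiffAt_dirDeriv {f : P → ℝ} (hf : ContMDiff J 𝓘(ℝ, ℝ) ∞ f)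
    {X : ∀ q : P, TangentSpace J q} {p : P}
    (hX : ContMDiffAt J J.tangent ∞ (fun q => (⟨q, X q⟩ : TangentBundle J P)) p) :
    ContMDiffAt J 𝓘(ℝ, ℝ) ∞ (fun q => dirDeriv J f q (X q)) p := by
  have h2 := (hf.contMDiff_tangentMap (m := ∞) (by simp)).contMDiffAt.comp p hX
  exact (contMDiff_snd_tangentBundle_modelSpace ℝ 𝓘(ℝ, ℝ)).contMDiffAt.comp p h2

/-- A combination with smooth coefficients of smooth sections along a map is smooth. -/
theorem contMDiffAt_sum_smul_along {ι : Type*} [Fintype ι] {pr : P → Q} {p : P}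
    (hpr : ContMDiffAt J (𝓡 m) ∞ pr p) {c : ι → P → ℝ}
    (hc : ∀ i, ContMDiffAt J 𝓘(ℝ, ℝ) ∞ (c i) p) (σ : ι → Sec m n E) :
    ContMDiffAt J ((𝓡 m).prod 𝓘(ℝ, Eucl (n + 1))) ∞
      (fun q => (⟨pr q, ∑ i, c i q • σ i (pr q)⟩ : TotalSpace (Eucl (n + 1)) E)) p := by
  have h1 (i : ι) := (Bundle.contMDiffAt_totalSpace.1
    ((σ i).contMDiff.contMDiffAt.comp p hpr)).2
  refine Bundle.contMDiffAt_totalSpace.2 ⟨hpr, ?_⟩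
  have h2 : ContMDiffAt J 𝓘(ℝ, Eucl (n + 1)) ∞ (fun q => ∑ i, c i q •
      (trivializationAt (Eucl (n + 1)) E (pr p) ⟨pr q, σ i (pr q)⟩).2) p :=
    contMDiffAt_finsetSum fun i _ => (hc i).smul (h1 i)
  refine h2.congr_of_eventuallyEq ?_
  filter_upwards [hpr.continuousAt.preimage_mem_nhds ((trivializationAt (Eucl (n + 1)) E
    (pr p)).open_baseSet.mem_nhds (mem_baseSet_trivializationAt ..))] with q hq
  have h3 (v : E (pr q)) := Trivialization.continuousLinearMapAt_apply_of_mem ℝ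
    (trivializationAt (Eucl (n + 1)) E (pr p)) hq v
  simp only [← h3, map_sum, map_smul]

namespace LieAffgebroid

variable (𝒜 : LieAffgebroid m n E)

/-- `negDLiouville` as a bilinear form. -/
def negDLiouvilleL (φ : 𝒜.DualTotal) : (Sec m n E × TangentSpace 𝒜.dualModel φ) →ₗ[ℝ]
    (Sec m n E × TangentSpace 𝒜.dualModel φ) →ₗ[ℝ] ℝ :=
  LinearMap.mk₂ ℝ (fun z w => 𝒜.negDLiouville φ z.1 w.1 z.2 w.2)
    (fun z z' w => 𝒜.negDLiouville_add_left ..) (fun c z w => 𝒜.negDLiouville_smul_left ..)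
    (fun z w w' => by
      rw [negDLiouville_antisymm, negDLiouville_antisymm _ _ z.1 w.1,
        negDLiouville_antisymm _ _ z.1 w'.1, ← neg_add, ← negDLiouville_add_left]
      rfl)
    (fun c z w => by
      rw [negDLiouville_antisymm, negDLiouville_antisymm _ _ z.1 w.1, smul_eq_mul, mul_neg,
        ← negDLiouville_smul_left]
      rfl)

/-- The expression is bilinear over ℝ in pairs (σ, X) with no compatibility between σ and X, so it
may be expanded on frame members outside the prolongation. -/
theorem negDLiouville_sum {ι : Type*} [Fintype ι] (φ : 𝒜.DualTotal) (σ : ι → Sec m n E)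
    (X : ι → TangentSpace 𝒜.dualModel φ) (u v : ι → ℝ) :
    𝒜.negDLiouville φ (∑ A, u A • σ A) (∑ A, v A • σ A) (∑ A, u A • X A) (∑ A, v A • X A) =
      ∑ A, ∑ B, 𝒜.negDLiouville φ (σ A) (σ B) (X A) (X B) * (u A * v B) := by
  have h (u : ι → ℝ) : ((∑ A, u A • σ A, ∑ A, u A • X A) :
      Sec m n E × TangentSpace 𝒜.dualModel φ) = ∑ A, u A • (σ A, X A) := by
    refine Prod.ext ?_ ?_
    · rw [Prod.fst_sum]; rfl
    · rw [Prod.snd_sum]; rfl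
  change 𝒜.negDLiouvilleL φ (∑ A, u A • σ A, ∑ A, u A • X A) (∑ A, v A • σ A, ∑ A, v A • X A) = _
  rw [h, h, map_sum (𝒜.negDLiouvilleL φ), LinearMap.sum_apply]
  refine Finset.sum_congr rfl fun A _ => ?_
  rw [map_sum]
  refine Finset.sum_congr rfl fun B _ => ?_
  rw [map_smul, map_smul, LinearMap.smul_apply, smul_eq_mul, smul_eq_mul]
  change v B * (u A * 𝒜.negDLiouville φ (σ A) (σ B) (X A) (X B)) = _
  ring

theorem map_sum_smul {ι V W : Type*} [Fintype ι] [AddCommGroup V] [Module ℝ V] [AddCommGroup W]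
    [Module ℝ W] (f : V →ₗ[ℝ] W) (u : ι → ℝ) (X : ι → V) :
    f (∑ A, u A • X A) = ∑ A, u A • f (X A) := by
  simp only [map_sum, map_smul]

/-- The pullback along `Φ` of the canonical form, in terms of its values on a frame. -/
theorem canonicalForm_sum {ι : Type*} [Fintype ι] {Φ : P → 𝒜.DualTotal} {p : P}
    (hΦ : MDifferentiableAt J 𝒜.dualModel Φ p) (σ : ι → Sec m n E)
    (X : ι → TangentSpace J p) (u v : ι → ℝ)
    (hu : (∑ A, u A • σ A (Φ p).proj, ∑ A, u A • X A) ∈ 𝒜.prolong J (fun p => (Φ p).proj) p)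
    (hv : (∑ A, v A • σ A (Φ p).proj, ∑ A, v A • X A) ∈ 𝒜.prolong J (fun p => (Φ p).proj) p) :
    𝒜.canonicalForm (Φ p)
      (∑ A, u A • σ A (Φ p).proj, mfderiv J 𝒜.dualModel Φ p (∑ A, u A • X A))
      (∑ A, v A • σ A (Φ p).proj, mfderiv J 𝒜.dualModel Φ p (∑ A, v A • X A)) =
    ∑ A, ∑ B, 𝒜.negDLiouville (Φ p) (σ A) (σ B) (mfderiv J 𝒜.dualModel Φ p (X A))
      (mfderiv J 𝒜.dualModel Φ p (X B)) * (u A * v B) := by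
  have hproj : MDifferentiableAt 𝒜.dualModel (𝓡 m) (TotalSpace.proj : 𝒜.DualTotal → Q) (Φ p) :=
    (Bundle.contMDiff_proj _ (n := ∞)).mdifferentiableAt (by simp)
  have hsum (u : ι → ℝ) : (∑ A, u A • σ A) (Φ p).proj = ∑ A, u A • σ A (Φ p).proj :=
    sec_sum_apply _ _ _
  -- Only the two full sums lie in the prolongation, so the change of extensions is made on them,
  -- before expanding.
  refine (𝒜.canonicalForm_eq (Φ p) _ _ (𝒜.prolongMap TotalSpace.proj Φ p hproj hΦ ⟨_, hu⟩).2
    (𝒜.prolongMap TotalSpace.proj Φ p hproj hΦ ⟨_, hv⟩).2 _ _ (hsum u) (hsum v)).trans ?_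
  have hlin (u : ι → ℝ) : mfderiv J 𝒜.dualModel Φ p (∑ A, u A • X A) =
      ∑ A, u A • mfderiv J 𝒜.dualModel Φ p (X A) :=
    map_sum_smul (mfderiv J 𝒜.dualModel Φ p).toLinearMap u X
  rw [← negDLiouville_sum]
  exact congrArg₂ (𝒜.negDLiouville (Φ p) _ _) (hlin u) (hlin v)

/-- By the chain rule the derivative along TΦ(X) of a function on A⁺ is the derivative along X of
its pullback, so everything reduces to smooth functions and fields on P. -/
theorem contMDiffAt_negDLiouville {Φ : P → 𝒜.DualTotal} (hΦ : ContMDiff J 𝒜.dualModel ∞ Φ)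
    (σ τ : Sec m n E) {X Y : ∀ q : P, TangentSpace J q} {p : P}
    (hX : ContMDiffAt J J.tangent ∞ (fun q => (⟨q, X q⟩ : TangentBundle J P)) p)
    (hY : ContMDiffAt J J.tangent ∞ (fun q => (⟨q, Y q⟩ : TangentBundle J P)) p) :
    ContMDiffAt J 𝓘(ℝ, ℝ) ∞ (fun q => 𝒜.negDLiouville (Φ q) σ τ
      (mfderiv J 𝒜.dualModel Φ q (X q)) (mfderiv J 𝒜.dualModel Φ q (Y q))) p := by
  have h (σ : Sec m n E) (X : ∀ q : P, TangentSpace J q) (q : P) :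
      dirDeriv 𝒜.dualModel (𝒜.evalSec σ) (Φ q) (mfderiv J 𝒜.dualModel Φ q (X q)) =
        dirDeriv J (𝒜.evalSec σ ∘ Φ) q (X q) := by
    have h1 := mfderiv_comp q (𝒜.mdifferentiableAt_evalSec σ (Φ q))
      (hΦ.mdifferentiableAt (x := q) (by simp))
    exact (congrArg (fun A : TangentSpace J q →L[ℝ] ℝ => A (X q)) h1).symm
  simp only [negDLiouville_def, h]
  exact (((contMDiffAt_dirDeriv ((𝒜.contMDiff_evalSec τ).comp hΦ) hX).sub
    (contMDiffAt_dirDeriv ((𝒜.contMDiff_evalSec σ).comp hΦ) hY)).sub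
    (((𝒜.contMDiff_evalSec _).comp hΦ) p)).neg

/-- The smoothness of Reeb sections, tested on a local frame of `pr^* E ⊕ TP`. -/
theorem contMDiffAt_of_reeb_of_frame {ι : Type*} [Fintype ι] {Φ : P → 𝒜.DualTotal} (hΦ : ContMDiff J 𝒜.dualModel ∞ Φ) {r : ℕ}
    (hrank : ∀ p, Module.finrank ℝ (𝒜.prolong J (fun p => (Φ p).proj) p) = r)
    (a : ∀ p, E (Φ p).proj) (Y : ∀ p : P, TangentSpace J p)
    (hmem : ∀ p, (a p, Y p) ∈ 𝒜.prolong J (fun p => (Φ p).proj) p)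
    (hΩ : ∀ p, ∀ z ∈ 𝒜.prolong J (fun p => (Φ p).proj) p, 𝒜.canonicalForm (Φ p)
      (a p, mfderiv J 𝒜.dualModel Φ p (Y p)) (z.1, mfderiv J 𝒜.dualModel Φ p z.2) = 0)
    (hη : ∀ p, 𝒜.one (Φ p).proj (a p) = (1 : ℝ))
    (hnd : ∀ p, ∀ z ∈ 𝒜.prolong J (fun p => (Φ p).proj) p,
      (∀ w ∈ 𝒜.prolong J (fun p => (Φ p).proj) p, 𝒜.canonicalForm (Φ p)
        (z.1, mfderiv J 𝒜.dualModel Φ p z.2) (w.1, mfderiv J 𝒜.dualModel Φ p w.2) = 0) →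
      𝒜.one (Φ p).proj z.1 = (0 : ℝ) → z = 0) (p : P)
    (σ : ι → Sec m n E) (X : ι → ∀ q : P, TangentSpace J q)
    (hX : ∀ A, ContMDiffAt J J.tangent ∞ (fun q => (⟨q, X A q⟩ : TangentBundle J P)) p)
    (hbij : ∀ᶠ q in 𝓝 p, Function.Bijective (fun u : ι → ℝ =>
      ((∑ A, u A • σ A (Φ q).proj, ∑ A, u A • X A q) : E (Φ q).proj × TangentSpace J q))) :
    ContMDiffAt J ((𝓡 m).prod 𝓘(ℝ, Eucl (n + 1))) ∞
        (fun q => (⟨(Φ q).proj, a q⟩ : TotalSpace (Eucl (n + 1)) E)) p ∧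
      ContMDiffAt J J.tangent ∞ (fun q => (⟨q, Y q⟩ : TangentBundle J P)) p := by
  set pr : P → Q := fun p => (Φ p).proj with hprdef
  have hpr : ContMDiff J (𝓡 m) ∞ pr := (Bundle.contMDiff_proj _).comp hΦ
  have hΦd (q : P) : MDifferentiableAt J 𝒜.dualModel Φ q := hΦ.mdifferentiableAt (by simp)
  let κ : ∀ q : P, (ι → ℝ) → E (pr q) × TangentSpace J q := fun q u =>
    (∑ A, u A • σ A (pr q), ∑ A, u A • X A q)
  set tQ := trivializationAt (Eucl m) (TangentSpace (𝓡 m) : Q → Type _) (pr p)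
  -- The defect ρ(σ_A) - Tpr(X_A), read in a trivialization of TQ. The map G built from it has the
  -- prolongation as its kernel, in frame coordinates.
  let g : ι → P → Eucl m := fun A q => (tQ ⟨pr q, 𝒜.anchor (pr q) (σ A (pr q))⟩).2 -
    (tQ ⟨pr q, mfderiv J (𝓡 m) pr q (X A q)⟩).2
  have hg (A : ι) : ContMDiffAt J 𝓘(ℝ, Eucl m) ∞ (g A) p := by
    have h1 : ContMDiff (𝓡 m) (𝓡 m).tangent ∞
        (fun x : Q => (⟨x, 𝒜.anchor x (σ A x)⟩ : TangentBundle (𝓡 m) Q)) :=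
      ContMDiff.clm_bundle_apply (b := fun x : Q => x) 𝒜.anchor.contMDiff (σ A).contMDiff
    have h2 := (hpr.contMDiff_tangentMap (m := ∞) (by simp)).contMDiffAt.comp p (hX A)
    exact (Bundle.contMDiffAt_totalSpace.1 ((h1.comp hpr) p)).2.sub
      (Bundle.contMDiffAt_totalSpace.1 h2).2
  let O : ι → ι → P → ℝ := fun A B q => 𝒜.negDLiouville (Φ q) (σ A) (σ B)
    (mfderiv J 𝒜.dualModel Φ q (X A q)) (mfderiv J 𝒜.dualModel Φ q (X B q))
  have hO (A B : ι) : ContMDiffAt J 𝓘(ℝ, ℝ) ∞ (O A B) p :=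
    𝒜.contMDiffAt_negDLiouville hΦ (σ A) (σ B) (hX A) (hX B)
  let h : ι → P → ℝ := fun A q => pair 𝒜.one (σ A) (pr q)
  have hh (A : ι) : ContMDiffAt J 𝓘(ℝ, ℝ) ∞ (h A) p := ((pair 𝒜.one (σ A)).contMDiff.comp hpr) p
  let pA : ι → (ι → ℝ) →L[ℝ] ℝ := fun A => ContinuousLinearMap.proj A
  let G : P → (ι → ℝ) →L[ℝ] Eucl m := fun q => ∑ A, (pA A).smulRight (g A q)
  -- The matrix of Ω + η ⊗ η. The added square makes it nondegenerate on the prolongation, and the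
  -- Reeb section ζ satisfies B(ζ, ·) = η there.
  let B : P → (ι → ℝ) →L[ℝ] (ι → ℝ) →L[ℝ] ℝ := fun q =>
    ∑ A, ∑ B, (O A B q + h A q * h B q) • (pA A).smulRight (pA B)
  let β : P → (ι → ℝ) →L[ℝ] ℝ := fun q => ∑ A, h A q • pA A
  have hG : ContMDiffAt J 𝓘(ℝ, (ι → ℝ) →L[ℝ] Eucl m) ∞ G p :=
    contMDiffAt_finsetSum fun A _ => (contMDiffAt_const (c :=
      ContinuousLinearMap.smulRightL ℝ (ι → ℝ) (Eucl m) (pA A))).clm_apply (hg A)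
  have hB : ContMDiffAt J 𝓘(ℝ, (ι → ℝ) →L[ℝ] (ι → ℝ) →L[ℝ] ℝ) ∞ B p :=
    contMDiffAt_finsetSum fun A _ => contMDiffAt_finsetSum fun B _ =>
      ((hO A B).add ((hh A).mul (hh B))).smul contMDiffAt_const
  have hβ : ContMDiffAt J 𝓘(ℝ, (ι → ℝ) →L[ℝ] ℝ) ∞ β p :=
    contMDiffAt_finsetSum fun A _ => (hh A).smul contMDiffAt_const
  have hGapply (q : P) (u : ι → ℝ) : G q u = ∑ A, u A • g A q := by
    simp only [G, sum_apply]
    rfl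
  have hβapply (q : P) (u : ι → ℝ) : β q u = 𝒜.one (pr q) (κ q u).1 := by
    simp only [β, sum_apply, κ, map_sum, map_smul]
    exact Finset.sum_congr rfl fun A _ => mul_comm _ _
  have hBapply (q : P) (u v : ι → ℝ) : B q u v =
      ∑ A, ∑ B, O A B q * (u A * v B) + β q u * β q v := by
    simp only [B, β, sum_apply, Finset.sum_mul_sum, ← Finset.sum_add_distrib]
    refine Finset.sum_congr rfl fun A _ => Finset.sum_congr rfl fun B _ => ?_
    change (O A B q + h A q * h B q) * (u A * v B) =
      O A B q * (u A * v B) + h A q * u A * (h B q * v B)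
    ring
  have hGker : ∀ᶠ q in 𝓝 p, ∀ u, G q u = 0 ↔ κ q u ∈ 𝒜.prolong J pr q := by
    filter_upwards [hpr.continuous.continuousAt.preimage_mem_nhds (tQ.open_baseSet.mem_nhds
      (mem_baseSet_trivializationAt _ _ (pr p)))] with q hq u
    have h1 (v : TangentSpace (𝓡 m) (pr q)) : tQ.continuousLinearEquivAt ℝ (pr q) hq v =
      (tQ ⟨pr q, v⟩).2 := rfl
    have h2 : G q u = tQ.continuousLinearEquivAt ℝ (pr q) hq
        (𝒜.anchor (pr q) (κ q u).1 - mfderiv J (𝓡 m) pr q (κ q u).2) := by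
      simp only [hGapply, g, κ, map_sub, map_sum, map_smul, ← h1, smul_sub, Finset.sum_sub_distrib]
    rw [h2, map_eq_zero_iff _ (tQ.continuousLinearEquivAt ℝ (pr q) hq).injective, sub_eq_zero]
    rfl
  -- The coordinates of the section in the frame.
  let c : P → ι → ℝ := fun q => Function.invFun (κ q) (a q, Y q)
  have hκc : ∀ᶠ q in 𝓝 p, κ q (c q) = (a q, Y q) := by
    filter_upwards [hbij] with q hq using Function.invFun_eq (hq.surjective _)
  have hrankG : ∀ᶠ q in 𝓝 p, Module.finrank ℝ (LinearMap.ker (G q : (ι → ℝ) →ₗ[ℝ] Eucl m)) = r := by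
    filter_upwards [hbij, hGker] with q hq hGq
    let κL : (ι → ℝ) →ₗ[ℝ] E (pr q) × TangentSpace J q :=
      { toFun := κ q
        map_add' := fun u v => by simp [κ, add_smul, Finset.sum_add_distrib]
        map_smul' := fun t u => by simp [κ, mul_smul, Finset.smul_sum] }
    have hmap : Submodule.map κL (LinearMap.ker (G q : (ι → ℝ) →ₗ[ℝ] Eucl m)) =
        𝒜.prolong J pr q := by
      ext z
      constructor
      · rintro ⟨u, hu, rfl⟩
        exact (hGq u).1 hu
      · intro hz
        obtain ⟨u, hu⟩ := hq.surjective z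
        have hu : κ q u = z := hu
        exact ⟨u, (hGq u).2 (by rwa [hu]), hu⟩
    rw [← hrank q, ← hmap]
    exact (Submodule.equivMapOfInjective κL hq.injective _).finrank_eq
  have hBker : ∀ᶠ q in 𝓝 p, ∀ u v, G q u = 0 → G q v = 0 → B q u v =
      𝒜.canonicalForm (Φ q) ((κ q u).1, mfderiv J 𝒜.dualModel Φ q (κ q u).2)
        ((κ q v).1, mfderiv J 𝒜.dualModel Φ q (κ q v).2) +
      𝒜.one (pr q) (κ q u).1 * (𝒜.one (pr q) (κ q v).1 : ℝ) := by
    filter_upwards [hGker] with q hGq u v hu hv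
    rw [hBapply, hβapply, hβapply, 𝒜.canonicalForm_sum (hΦd q) σ (fun A => X A q) u v
      ((hGq u).1 hu) ((hGq v).1 hv)]
  have hcsmooth : ContMDiffAt J 𝓘(ℝ, ι → ℝ) ∞ c p := by
    refine contMDiffAt_of_kernel_equation hG hB hβ ?_ ?_ ?_
    · filter_upwards [hrankG] with q hq
      rw [hq, hrankG.self_of_nhds]
    · filter_upwards [hκc, hGker, hBker] with q hq hGq hBq
      have hGc : G q (c q) = 0 := (hGq _).2 (by rw [hq]; exact hmem q)
      refine ⟨hGc, fun z hz => ?_⟩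
      rw [hBq _ _ hGc hz, hβapply, hq, hη q]
      exact (congrArg₂ (· + ·) (hΩ q _ ((hGq z).1 hz)) (one_mul _)).trans (zero_add _)
    · intro z hz hzB
      have hbijp := hbij.self_of_nhds
      have hGp := hGker.self_of_nhds
      have hBp := hBker.self_of_nhds
      -- Testing z against itself removes the skew part and leaves η(z)² = 0; then B(z, ·) = 0
      -- reduces to Ω(z, ·) = 0.
      have hη0 : 𝒜.one (pr p) (κ p z).1 = (0 : ℝ) := by
        have h1 := hBp z z hz hz
        have h2 : 𝒜.canonicalForm (Φ p) ((κ p z).1, mfderiv J 𝒜.dualModel Φ p (κ p z).2)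
            ((κ p z).1, mfderiv J 𝒜.dualModel Φ p (κ p z).2) =
          -𝒜.canonicalForm (Φ p) ((κ p z).1, mfderiv J 𝒜.dualModel Φ p (κ p z).2)
            ((κ p z).1, mfderiv J 𝒜.dualModel Φ p (κ p z).2) := 𝒜.negDLiouville_antisymm ..
        have h3 := hzB z hz
        have h4 : (𝒜.one (pr p) (κ p z).1 : ℝ) * (𝒜.one (pr p) (κ p z).1 : ℝ) = 0 := by linarith
        exact mul_self_eq_zero.1 h4
      have hκ0 : κ p z = 0 := by
        refine hnd p _ ((hGp z).1 hz) (fun w hw => ?_) hη0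
        obtain ⟨v, hv⟩ := hbijp.surjective w
        have hv : κ p v = w := hv
        have hGv : G p v = 0 := (hGp v).2 (by rwa [hv])
        have h1 := hBp z v hz hGv
        have h2 : (𝒜.one (pr p) (κ p z).1 : ℝ) * (𝒜.one (pr p) (κ p v).1 : ℝ) = 0 :=
          mul_eq_zero_of_left hη0 _
        have h3 := hzB v hGv
        rw [← hv]
        linarith
      refine hbijp.injective (hκ0.trans ?_)
      simp
      rfl
  have hcA (A : ι) : ContMDiffAt J 𝓘(ℝ, ℝ) ∞ (fun q => c q A) p :=
    (contMDiffAt_const (c := pA A)).clm_apply hcsmooth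
  constructor
  · refine (contMDiffAt_sum_smul_along (hpr p) hcA σ).congr_of_eventuallyEq ?_
    filter_upwards [hκc] with q hq
    exact congrArg (TotalSpace.mk (pr q)) (congrArg Prod.fst hq).symm
  · have h1 : ContMDiffAt J J.tangent ∞
        (fun q => (⟨q, ∑ A, c q A • X A q⟩ : TangentBundle J P)) p :=
      .sum_section fun A _ => (hcA A).smul_section (hX A)
    refine h1.congr_of_eventuallyEq ?_
    filter_upwards [hκc] with q hq
    exact congrArg (TotalSpace.mk q) (congrArg Prod.snd hq).symm

/-- A section of the prolongation over `pr = proj ∘ Φ` characterized by the equations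
`i_ζ Ω = 0` and `i_ζ η = 1`, where `(Ω, η)` is the pullback along `Φ` of the canonical form and
`1_A`, is smooth. -/
theorem contMDiffAt_of_reeb {Φ : P → 𝒜.DualTotal} (hΦ : ContMDiff J 𝒜.dualModel ∞ Φ) {r : ℕ}
    (hrank : ∀ p, Module.finrank ℝ (𝒜.prolong J (fun p => (Φ p).proj) p) = r)
    (a : ∀ p, E (Φ p).proj) (Y : ∀ p : P, TangentSpace J p)
    (hmem : ∀ p, (a p, Y p) ∈ 𝒜.prolong J (fun p => (Φ p).proj) p)
    (hΩ : ∀ p, ∀ z ∈ 𝒜.prolong J (fun p => (Φ p).proj) p, 𝒜.canonicalForm (Φ p)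
      (a p, mfderiv J 𝒜.dualModel Φ p (Y p)) (z.1, mfderiv J 𝒜.dualModel Φ p z.2) = 0)
    (hη : ∀ p, 𝒜.one (Φ p).proj (a p) = (1 : ℝ))
    (hnd : ∀ p, ∀ z ∈ 𝒜.prolong J (fun p => (Φ p).proj) p,
      (∀ w ∈ 𝒜.prolong J (fun p => (Φ p).proj) p, 𝒜.canonicalForm (Φ p)
        (z.1, mfderiv J 𝒜.dualModel Φ p z.2) (w.1, mfderiv J 𝒜.dualModel Φ p w.2) = 0) →
      𝒜.one (Φ p).proj z.1 = (0 : ℝ) → z = 0) (p : P) :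
    ContMDiffAt J ((𝓡 m).prod 𝓘(ℝ, Eucl (n + 1))) ∞
        (fun q => (⟨(Φ q).proj, a q⟩ : TotalSpace (Eucl (n + 1)) E)) p ∧
      ContMDiffAt J J.tangent ∞ (fun q => (⟨q, Y q⟩ : TangentBundle J P)) p := by
  have hpr : ContMDiff J (𝓡 m) ∞ (fun p => (Φ p).proj) := (Bundle.contMDiff_proj _).comp hΦ
  obtain ⟨σ, X, hX, hbij⟩ := exists_sum_frame m n E J _ hpr.continuous p
  exact 𝒜.contMDiffAt_of_reeb_of_frame hΦ hrank a Y hmem hΩ hη hnd p σ X hX hbij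

end LieAffgebroid
end Smoothness

/-! ### The Reeb section over W₁' and its identification with the vakonomic solution. -/

section Vakonomic

variable {m n : ℕ} {Q : Type*} [TopologicalSpace Q] [ChartedSpace (Eucl m) Q]
  [IsManifold (𝓡 m) ∞ Q] [T2Space Q] [SigmaCompactSpace Q]
  {E : Q → Type*} [∀ x, AddCommGroup (E x)] [∀ x, Module ℝ (E x)]
  [∀ x, TopologicalSpace (E x)] [TopologicalSpace (TotalSpace (Eucl (n + 1)) E)]
  [FiberBundle (Eucl (n + 1)) E] [VectorBundle ℝ (Eucl (n + 1)) E]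
  [ContMDiffVectorBundle ∞ (Eucl (n + 1)) E (𝓡 m)]
  {𝒜 : LieAffgebroid m n E} {d : ℕ} {M : Set (TotalSpace (Eucl (n + 1)) E)}
  [ChartedSpace (Eucl d) M] [IsManifold (𝓡 d) ∞ M]

namespace LieAffgebroid

variable (hM : 𝒜.IsConstraintSubmanifold d M) (L : TotalSpace (Eucl (n + 1)) E → ℝ)

/-- L is smooth only along A, which suffices because the M-component of a point of W₀ lies in A. -/
theorem contMDiff_pontryagin
    (hL : ContMDiffOn ((𝓡 m).prod 𝓘(ℝ, Eucl (n + 1))) 𝓘(ℝ, ℝ) ∞ L 𝒜.total) :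
    ContMDiff (W₀model hM) 𝓘(ℝ, ℝ) ∞ (pontryagin hM L) := by
  have hproj : ContMDiff (W₀model hM) (𝓡 d) ∞ (TotalSpace.proj : W₀ hM → M) :=
    Bundle.contMDiff_proj _
  have he : ContMDiff (W₀model hM) ((𝓡 m).prod 𝓘(ℝ, Eucl (n + 1))) ∞
      (fun w : W₀ hM => (w.proj.1 : TotalSpace (Eucl (n + 1)) E)) :=
    hM.embedded.contMDiff.comp hproj
  have hLe : ContMDiff (W₀model hM) 𝓘(ℝ, ℝ) ∞ (fun w : W₀ hM => L w.proj.1) :=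
    hL.comp_contMDiff he fun w => hM.subset w.proj.2
  have hev := ContMDiff.clm_bundle_apply (F₁ := Eucl (n + 1)) (F₂ := ℝ) (E₁ := E)
    (E₂ := Bundle.Trivial Q ℝ) (b := ν hM) (ϕ := fun w => (π₁ hM w).2) (v := fun w => w.proj.1.2)
    (contMDiff_π₁ hM) he
  have hev' : ContMDiff (W₀model hM) 𝓘(ℝ, ℝ) ∞
      (fun w : W₀ hM => ((π₁ hM w).2 w.proj.1.2 : ℝ)) :=
    fun w => (Bundle.contMDiffAt_totalSpace.1 (hev w)).2
  exact hev'.sub hLe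

variable (k : ℕ) [ChartedSpace (Eucl k) (W₁' hM L)] [IsManifold (𝓡 k) ∞ (W₁' hM L)]

/-- The differential of the Pontryagin Hamiltonian vanishes along `W₁'`. -/
theorem dPontryagin_incl
    (hL : ContMDiffOn ((𝓡 m).prod 𝓘(ℝ, Eucl (n + 1))) 𝓘(ℝ, ℝ) ∞ L 𝒜.total)
    (hW : ContMDiff (𝓡 k) (W₀model hM) ∞ (Subtype.val : W₁' hM L → W₀ hM))
    (w : W₁' hM L) (z : E (ν₁' hM L w) × TangentSpace (𝓡 k) w) :
    dPontryagin hM L w.1 (incl hM L k w z) = 0 := by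
  have h := mfderiv_comp w (((contMDiff_pontryagin hM L hL) w.1).mdifferentiableAt (by simp))
    ((hW w).mdifferentiableAt (by simp))
  -- H is identically zero on W₁' by definition, so its derivative along W₁' vanishes.
  have hc : pontryagin hM L ∘ (Subtype.val : W₁' hM L → W₀ hM) = fun _ => 0 :=
    funext fun w => w.2.2
  rw [hc, mfderiv_const] at h
  exact (congrArg (fun f => f z.2) h).symm

/-- On `W₁'`, the form `Ω_{W₁'}` is the pullback of the canonical form along `W₁' → A^+`. -/
theorem OmegaW₁'_eq
    (hL : ContMDiffOn ((𝓡 m).prod 𝓘(ℝ, Eucl (n + 1))) 𝓘(ℝ, ℝ) ∞ L 𝒜.total)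
    (hW : ContMDiff (𝓡 k) (W₀model hM) ∞ (Subtype.val : W₁' hM L → W₀ hM))
    (w : W₁' hM L) (z z' : E (ν₁' hM L w) × TangentSpace (𝓡 k) w) :
    OmegaW₁' hM L k w z z' = 𝒜.canonicalForm (π₁ hM w.1)
      (z.1, mfderiv (𝓡 k) 𝒜.dualModel (fun w : W₁' hM L => π₁ hM w.1) w z.2)
      (z'.1, mfderiv (𝓡 k) 𝒜.dualModel (fun w : W₁' hM L => π₁ hM w.1) w z'.2) := by
  have h := mfderiv_comp w (((contMDiff_π₁ hM) w.1).mdifferentiableAt (by simp))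
    ((hW w).mdifferentiableAt (by simp))
  have h1 : OmegaW₁' hM L k w z z' = Omega hM w.1 (incl hM L k w z) (incl hM L k w z') +
      (dPontryagin hM L w.1 (incl hM L k w z) * eta hM w.1 (incl hM L k w z') -
        dPontryagin hM L w.1 (incl hM L k w z') * eta hM w.1 (incl hM L k w z)) := rfl
  rw [h1, dPontryagin_incl hM L k hL hW w z, dPontryagin_incl hM L k hL hW w z', zero_mul,
    zero_mul, sub_zero, add_zero]
  exact (congrArg (fun f : TangentSpace (𝓡 k) w →L[ℝ] TangentSpace 𝒜.dualModel (π₁ hM w.1) =>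
    𝒜.canonicalForm (π₁ hM w.1) (z.1, f z.2) (z'.1, f z'.2)) h).symm

theorem ProlSection.ext_val {EP : Type*} [NormedAddCommGroup EP] [NormedSpace ℝ EP] {HP : Type*}
    [TopologicalSpace HP] {J : ModelWithCorners ℝ EP HP} {P : Type*} [TopologicalSpace P]
    [ChartedSpace HP P] [IsManifold J ∞ P] {pr : P → Q} {ζ ζ' : 𝒜.ProlSection J pr}
    (h : ∀ p, ζ.val p = ζ'.val p) : ζ = ζ' := by
  have h1 : ζ.fst = ζ'.fst := funext fun p => congrArg Prod.fst (h p)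
  have h2 : ζ.snd = ζ'.snd := funext fun p => congrArg Prod.snd (h p)
  cases ζ
  cases ζ'
  cases h1
  cases h2
  rfl

/-- The cosymplectic structure of `𝒯^Ã W₁'` has a smooth Reeb section. -/
theorem exists_isReebW₁'
    (hL : ContMDiffOn ((𝓡 m).prod 𝓘(ℝ, Eucl (n + 1))) 𝓘(ℝ, ℝ) ∞ L 𝒜.total)
    (hW : ContMDiff (𝓡 k) (W₀model hM) ∞ (Subtype.val : W₁' hM L → W₀ hM))
    (hcos : 𝒜.IsCosymplectic (𝓡 k) (ν₁' hM L) n (OmegaW₁' hM L k) (etaW₁' hM L k)) :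
    ∃ ζ : 𝒜.ProlSection (𝓡 k) (ν₁' hM L),
      𝒜.IsReeb (𝓡 k) (ν₁' hM L) (OmegaW₁' hM L k) (etaW₁' hM L k) ζ := by
  -- The choice is made fibre by fibre with no regularity; uniqueness of the solution is what forces
  -- it to be smooth.
  choose R hR hηR using exists_reebW₁' hM L k hW hcos
  have hΦ : ContMDiff (𝓡 k) 𝒜.dualModel ∞ (fun w : W₁' hM L => π₁ hM w.1) :=
    (contMDiff_π₁ hM).comp hW
  have hΩ (w : W₁' hM L) (z) (hz : z ∈ 𝒜.prolong (𝓡 k) (ν₁' hM L) w) :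
      OmegaW₁' hM L k w (R w).1 z = 0 :=
    (OmegaW₁'L_apply hM L k hW w (R w) ⟨z, hz⟩).symm.trans (hR w ⟨z, hz⟩)
  have hsm := 𝒜.contMDiffAt_of_reeb hΦ hcos.rank (fun w => (R w).1.1) (fun w => (R w).1.2)
    (fun w => (R w).2) (fun w z hz => (OmegaW₁'_eq hM L k hL hW w (R w).1 z).symm.trans (hΩ w z hz))
    hηR fun w z hz h hη => congrArg Subtype.val
      (eq_zero_of_OmegaW₁'L_of_etaW₁'L hM L k hW hcos w ⟨z, hz⟩ (fun u =>
        (OmegaW₁'L_apply hM L k hW w ⟨z, hz⟩ u).trans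
          ((OmegaW₁'_eq hM L k hL hW w z u.1).trans (h u.1 u.2))) hη)
  exact ⟨⟨fun w => (R w).1.1, fun w => (R w).1.2, fun w => (R w).2, fun w => (hsm w).1,
    fun w => (hsm w).2⟩, fun w => ⟨hΩ w, hηR w⟩⟩

theorem IsReeb.eq_of_W₁'
    (hW : ContMDiff (𝓡 k) (W₀model hM) ∞ (Subtype.val : W₁' hM L → W₀ hM))
    (hcos : 𝒜.IsCosymplectic (𝓡 k) (ν₁' hM L) n (OmegaW₁' hM L k) (etaW₁' hM L k))
    {ζ ζ' : 𝒜.ProlSection (𝓡 k) (ν₁' hM L)}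
    (hζ : 𝒜.IsReeb (𝓡 k) (ν₁' hM L) (OmegaW₁' hM L k) (etaW₁' hM L k) ζ)
    (hζ' : 𝒜.IsReeb (𝓡 k) (ν₁' hM L) (OmegaW₁' hM L k) (etaW₁' hM L k) ζ') : ζ = ζ' := by
  refine ProlSection.ext_val fun w => congrArg Subtype.val (sub_eq_zero.1
    (eq_zero_of_OmegaW₁'L_of_etaW₁'L hM L k hW hcos w (⟨_, ζ.mem w⟩ - ⟨_, ζ'.mem w⟩)
      (fun u => ?_) ?_))
  · rw [map_sub, LinearMap.sub_apply, OmegaW₁'L_apply, OmegaW₁'L_apply]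
    exact sub_eq_zero.2 (((hζ w).1 u u.2).trans ((hζ' w).1 u u.2).symm)
  · rw [map_sub]
    exact sub_eq_zero.2 ((hζ w).2.trans (hζ' w).2.symm)

/-- A solution is Reeb by testing only on vectors tangent to W₁'. The converse, against all vectors
over W₀, is the rank argument of `OmegaW₀L_inclL_eq_zero`. -/
theorem isVakonomicSolution_iff_isReeb
    (hW : ContMDiff (𝓡 k) (W₀model hM) ∞ (Subtype.val : W₁' hM L → W₀ hM))
    (hcos : 𝒜.IsCosymplectic (𝓡 k) (ν₁' hM L) n (OmegaW₁' hM L k) (etaW₁' hM L k))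
    (ζ : 𝒜.ProlSection (𝓡 k) (ν₁' hM L)) :
    IsVakonomicSolution hM L k ζ ↔
      𝒜.IsReeb (𝓡 k) (ν₁' hM L) (OmegaW₁' hM L k) (etaW₁' hM L k) ζ := by
  refine ⟨fun h w => ⟨fun z hz => (h w).1 _ (inclL hM L k hW w ⟨z, hz⟩).2, (h w).2⟩,
    fun h w => ⟨fun z hz => ?_, (h w).2⟩⟩
  have h1 := OmegaW₀L_inclL_eq_zero hM L k hW hcos w ⟨_, ζ.mem w⟩
    (fun u => (OmegaW₁'L_apply hM L k hW w ⟨_, ζ.mem w⟩ u).trans ((h w).1 u u.2)) (h w).2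
  exact (OmegaW₀L_apply hM L w.1 (inclL hM L k hW w ⟨_, ζ.mem w⟩) ⟨z, hz⟩).symm.trans
    (LinearMap.congr_fun h1 ⟨z, hz⟩)

end LieAffgebroid
end Vakonomic

end Vakonomic

end

/-! ### Existence, uniqueness and the Reeb property combined. -/

theorem theorem3p4 (m n mbar k : ℕ) (hmbar : mbar ≤ n)
    {Q : Type*} [TopologicalSpace Q] [T2Space Q] [SigmaCompactSpace Q]
    [ChartedSpace (Vakonomic.Eucl m) Q] [IsManifold (𝓡 m) ∞ Q]
    {E : Q → Type*} [∀ x, AddCommGroup (E x)] [∀ x, Module ℝ (E x)]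
    [∀ x, TopologicalSpace (E x)] [TopologicalSpace (TotalSpace (Vakonomic.Eucl (n + 1)) E)]
    [FiberBundle (Vakonomic.Eucl (n + 1)) E] [VectorBundle ℝ (Vakonomic.Eucl (n + 1)) E]
    [ContMDiffVectorBundle ∞ (Vakonomic.Eucl (n + 1)) E (𝓡 m)]
    (𝒜 : Vakonomic.LieAffgebroid m n E)
    (M : Set (TotalSpace (Vakonomic.Eucl (n + 1)) E))
    [ChartedSpace (Vakonomic.Eucl (n + m - mbar)) M] [IsManifold (𝓡 (n + m - mbar)) ∞ M]
    (hM : 𝒜.IsConstraintSubmanifold (n + m - mbar) M)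
    (L : TotalSpace (Vakonomic.Eucl (n + 1)) E → ℝ)
    (hL : ContMDiffOn ((𝓡 m).prod 𝓘(ℝ, Vakonomic.Eucl (n + 1))) 𝓘(ℝ, ℝ) ∞ L 𝒜.total)
    [ChartedSpace (Vakonomic.Eucl k) (Vakonomic.LieAffgebroid.W₁' hM L)]
    [IsManifold (𝓡 k) ∞ (Vakonomic.LieAffgebroid.W₁' hM L)]
    (hW : IsSmoothEmbedding (𝓡 k) (Vakonomic.LieAffgebroid.W₀model hM) ∞
      (Subtype.val : Vakonomic.LieAffgebroid.W₁' hM L → Vakonomic.LieAffgebroid.W₀ hM))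
    (hcos : 𝒜.IsCosymplectic (𝓡 k) (Vakonomic.LieAffgebroid.ν₁' hM L) n
      (Vakonomic.LieAffgebroid.OmegaW₁' hM L k) (Vakonomic.LieAffgebroid.etaW₁' hM L k)) :
    ∃ ζ₁ : 𝒜.ProlSection (𝓡 k) (Vakonomic.LieAffgebroid.ν₁' hM L),
      (∀ ζ, Vakonomic.LieAffgebroid.IsVakonomicSolution hM L k ζ ↔ ζ = ζ₁) ∧
      (∀ ζ, 𝒜.IsReeb (𝓡 k) (Vakonomic.LieAffgebroid.ν₁' hM L)
        (Vakonomic.LieAffgebroid.OmegaW₁' hM L k) (Vakonomic.LieAffgebroid.etaW₁' hM L k) ζ ↔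
          ζ = ζ₁) := by
  obtain ⟨ζ₁, hζ₁⟩ := Vakonomic.LieAffgebroid.exists_isReebW₁' hM L k hL hW.contMDiff hcos
  have hR (ζ) : 𝒜.IsReeb (𝓡 k) (Vakonomic.LieAffgebroid.ν₁' hM L)
      (Vakonomic.LieAffgebroid.OmegaW₁' hM L k) (Vakonomic.LieAffgebroid.etaW₁' hM L k) ζ ↔
        ζ = ζ₁ :=
    ⟨fun h => h.eq_of_W₁' hM L k hW.contMDiff hcos hζ₁, fun h => h ▸ hζ₁⟩
  exact ⟨ζ₁, fun ζ => (Vakonomic.LieAffgebroid.isVakonomicSolution_iff_isReeb hM L k hW.contMDiff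
    hcos ζ).trans (hR ζ), hR⟩
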